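/- **Setting.** Let $m,d,n\ge 0$ be integers, $p>0$, let $\sigma:\mathbb R\to\mathbb R$ satisfy $\sigma(ct)=c^p\sigma(t)$ for all $c>0$, $t\in\mathbb R$, and let $X=(x_1,\dots,x_n)\in(\mathbb R^d)^n$. On $\Theta=(\mathbb R\times\mathbb R^d)^m$, with points $\theta=((a_i,w_i))_{i\le m}$, consider the realization map $\Phi_X(\theta)=(f_\theta(x_1),\dots,f_\theta(x_n))$ of the shallow network $f_\theta(x)=\sum_{i=1}^m a_i\sigma(w_i^\top x)$ and the action of $G=S_m\ltimes(\mathbb R_{>0})^m$ by permutation of the $m$ units and by the rescalings $(a_i,w_i)\mapsto(c_i^{-p}a_i,c_iw_i)$. Let $\Theta_{\mathrm{reg}}\subset\Theta$ be an open $G$-invariant set on which $\Phi_X$ is smooth, on which $G$ acts properly and locally freely (stabilizers are discrete), and such that for every $\theta\in\Theta_{\mathrm{reg}}$ the kernel of $D\Phi_X(\theta)$ is the orbit tangent space $T_\theta(G\cdot\theta)=\{((-p\xi_ia_i,\xi_iw_i))_{i\le m}:\xi\in\mathbb R^m\}$. Let $\mathcal M_{\mathrm{reg}}=\Theta_{\mathrm{reg}}/G$,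 with the smooth structure (of dimension $md$) for which the quotient map $q:\Theta_{\mathrm{reg}}\to\mathcal M_{\mathrm{reg}}$ is a smooth submersion, and let $\bar g$ be the Riemannian metric on $\mathcal M_{\mathrm{reg}}$ determined by $$\bar g_{q(\theta)}(Dq_\theta u,Dq_\theta v)=\tfrac1n\langle D\Phi_X(\theta)u,D\Phi_X(\theta)v\rangle_{\mathbb R^n}.$$ **Theorem (local convergence controlled by effective curvature).** Let $\bar{\mathcal L}:\mathcal M_{\mathrm{reg}}\to\mathbb R$ be smooth, let $x_*\in\mathcal M_{\mathrm{reg}}$ be a critical point of $\bar{\mathcal L}$, and let $U\ni x_*$ be an open set that is geodesically convex, in the sense that any two points of $U$ are joined by a geodesic segment of $(\mathcal M_{\mathrm{reg}},\bar g)$ contained in $U$. Suppose that there are constants $0<\mu\le L<\infty$ such that for every $x\in U$ and every $\xi\in T_x\mathcal M_{\mathrm{reg}}$ $$\mu\,\bar g_x(\xi,\xi)\le\operatorname{Hess}_{\bar g}\bar{\mathcal L}(x)(\xi,\xi)\le L\,\bar g_x(\xi,\xi),$$ where $\operatorname{Hess}_{\bar g}$ is the Riemannian Hessian (with respect to the Levi-Civita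 connection of $\bar g$). Then: 1. $x_*$ is the unique minimizer of $\bar{\mathcal L}$ in $U$. 2. Every $C^1$ solution $\gamma:[0,T)\to U$, $T\in(0,\infty]$, of the quotient gradient flow $\dot\gamma_t=-\operatorname{grad}_{\bar g}\bar{\mathcal L}(\gamma_t)$ satisfies $$\bar{\mathcal L}(\gamma_t)-\bar{\mathcal L}(x_*)\le e^{-2\mu t}\bigl(\bar{\mathcal L}(\gamma_0)-\bar{\mathcal L}(x_*)\bigr)\qquad\text{for all }t\in[0,T).$$ 3. If $md>0$, then for every $x\in U$ the effective extremal eigenvalues $$\lambda^{\mathrm{eff}}_{\min}(x)=\inf_{\xi\ne0}\frac{\operatorname{Hess}_{\bar g}\bar{\mathcal L}(x)(\xi,\xi)}{\bar g_x(\xi,\xi)},\qquad \lambda^{\mathrm{eff}}_{\max}(x)=\sup_{\xi\ne0}\frac{\operatorname{Hess}_{\bar g}\bar{\mathcal L}(x)(\xi,\xi)}{\bar g_x(\xi,\xi)}$$ satisfy $\mu\le\lambda^{\mathrm{eff}}_{\min}(x)$ and $\lambda^{\mathrm{eff}}_{\max}(x)\le L$, and the effective condition number $\kappa_{\mathrm{eff}}(x)=\lambda^{\mathrm{eff}}_{\max}(x)/\lambda^{\mathrm{eff}}_{\min}(x)$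 satisfies $\kappa_{\mathrm{eff}}(x)\le L/\mu$. -/

import Mathlib

open Set Filter Topology TopologicalSpace
open scoped Manifold ContDiff Bundle

noncomputable section

/-! ## Riemannian notions in charts -/

namespace Riem

variable {E : Type*} [NormedAddCommGroup E] [NormedSpace ℝ E]
  {M : Type*} [TopologicalSpace M] [ChartedSpace E M] [IsManifold 𝓘(ℝ, E) ∞ M]

/-- A smooth Riemannian metric on the manifold `M`. -/
abbrev Metric (E : Type*) [NormedAddCommGroup E] [NormedSpace ℝ E]
    (M : Type*) [TopologicalSpace M] [ChartedSpace E M] [IsManifold 𝓘(ℝ, E) ∞ M] :=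
  Bundle.ContMDiffRiemannianMetric 𝓘(ℝ, E) ∞ E (fun x : M => TangentSpace 𝓘(ℝ, E) x)

/-- The gradient of `f` at `x`: the tangent vector with `g (grad f) ξ = df ξ` for all `ξ`
(see `inner_grad`). -/
def grad (g : Metric E M) (f : M → ℝ) (x : M) : TangentSpace 𝓘(ℝ, E) x :=
  (g.inner x).inverse (mfderiv 𝓘(ℝ, E) 𝓘(ℝ, ℝ) f x)

/-- The metric in the chart at `x`: the bilinear form at the point `y` of the chart is the pullback
of `g` by the inverse chart. -/
def metricInChart (g : Metric E M) (x : M) (y : E) : E →L[ℝ] E →L[ℝ] ℝ :=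
  ContinuousLinearMap.bilinearComp (E := E) (F := E) (E' := E) (F' := E)
    (g.inner ((extChartAt 𝓘(ℝ, E) x).symm y))
    (mfderiv 𝓘(ℝ, E) 𝓘(ℝ, E) (extChartAt 𝓘(ℝ, E) x).symm y)
    (mfderiv 𝓘(ℝ, E) 𝓘(ℝ, E) (extChartAt 𝓘(ℝ, E) x).symm y)

/-- The Christoffel symbols of the Levi-Civita connection in the chart at `x`, at the point `y` of
the chart: `Γ(u, v)` is the vector with
`G(Γ(u, v), w) = (D_u G(v, w) + D_v G(u, w) - D_w G(u, v)) / 2` for all `w`,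
where `G` is the metric in the chart (see `metricInChart_christoffel`). -/
def christoffel (g : Metric E M) (x : M) (y u v : E) : E :=
  (metricInChart g x y).inverse
    ((1 / 2 : ℝ) • (fderiv ℝ (metricInChart g x) y u v + fderiv ℝ (metricInChart g x) y v u
      - ((fderiv ℝ (metricInChart g x) y).flip u).flip v))

/-- The Riemannian Hessian `ξ (η f) - (∇_ξ η) f` at `x`, with `∇` the Levi-Civita connection,
computed in the chart at `x` (a tangent vector at `x` is represented by its coordinates in the chart
at `x`, and `η` is extended with constant coordinates). -/
def hessian (g : Metric E M) (f : M → ℝ) (x : M) (ξ η : TangentSpace 𝓘(ℝ, E) x) : ℝ :=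
  let F : E → ℝ := f ∘ (extChartAt 𝓘(ℝ, E) x).symm
  let y : E := extChartAt 𝓘(ℝ, E) x x
  fderiv ℝ (fderiv ℝ F) y ξ η - fderiv ℝ F y (christoffel g x y ξ η)

/-- `c` is a geodesic on the interval `s`: it is `C²` on `s` and, at every `t ∈ s`, its coordinate
expression `u` in the chart at `c t` satisfies `u'' + Γ(u', u') = 0`. -/
structure IsGeodesicOn (g : Metric E M) (c : ℝ → M) (s : Set ℝ) : Prop where
  contMDiffOn : ContMDiffOn 𝓘(ℝ, ℝ) 𝓘(ℝ, E) 2 c s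
  geodesic_eq : ∀ t ∈ s,
    iteratedDerivWithin 2 (extChartAt 𝓘(ℝ, E) (c t) ∘ c) s t
      + christoffel g (c t) (extChartAt 𝓘(ℝ, E) (c t) (c t))
          (derivWithin (extChartAt 𝓘(ℝ, E) (c t) ∘ c) s t)
          (derivWithin (extChartAt 𝓘(ℝ, E) (c t) ∘ c) s t) = 0

/-- Any two points of `U` are joined by a geodesic segment contained in `U`. -/
def GeodesicallyConvex (g : Metric E M) (U : Set M) : Prop :=
  ∀ x ∈ U, ∀ y ∈ U, ∃ c : ℝ → M, IsGeodesicOn g c (Icc 0 1) ∧ c 0 = x ∧ c 1 = y ∧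
    ∀ t ∈ Icc (0 : ℝ) 1, c t ∈ U

/-- The interval `[0, T)`, where `T = ∞` is allowed. -/
def timeInterval (T : EReal) : Set ℝ := {t | 0 ≤ t ∧ (t : EReal) < T}

/-- `γ` is a `C¹` solution of `γ' = - grad f (γ)` on `[0, T)`. -/
def IsGradientFlow (g : Metric E M) (f : M → ℝ) (γ : ℝ → M) (T : EReal) : Prop :=
  ContMDiffOn 𝓘(ℝ, ℝ) 𝓘(ℝ, E) 1 γ (timeInterval T) ∧
    IsMIntegralCurveOn γ (fun x : M => -grad g f x) (timeInterval T)

/-- The Rayleigh quotients `Hess f (ξ, ξ) / g (ξ, ξ)`, `ξ ≠ 0`, at `x`. -/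
def rayleighSet (g : Metric E M) (f : M → ℝ) (x : M) : Set ℝ :=
  {r | ∃ ξ : TangentSpace 𝓘(ℝ, E) x, ξ ≠ 0 ∧ r = hessian g f x ξ ξ / g.inner x ξ ξ}

/-- The least effective eigenvalue of the Hessian at `x`. -/
def lambdaMin (g : Metric E M) (f : M → ℝ) (x : M) : ℝ := sInf (rayleighSet g f x)

/-- The greatest effective eigenvalue of the Hessian at `x`. -/
def lambdaMax (g : Metric E M) (f : M → ℝ) (x : M) : ℝ := sSup (rayleighSet g f x)

/-- The effective condition number at `x`. -/
def kappa (g : Metric E M) (f : M → ℝ) (x : M) : ℝ := lambdaMax g f x / lambdaMin g f x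

/-- A positive definite form on a finite-dimensional space induces a musical isomorphism. -/
theorem apply_inverse [FiniteDimensional ℝ E]
    (B : E →L[ℝ] E →L[ℝ] ℝ) (hB : ∀ v, v ≠ 0 → 0 < B v v) (α : E →L[ℝ] ℝ) (ξ : E) :
    B (B.inverse α) ξ = α ξ := by
  have hinj : Function.Injective (B : E →ₗ[ℝ] E →L[ℝ] ℝ) := by
    rw [injective_iff_map_eq_zero]
    intro v hv
    by_contra h0
    have h1 := hB v h0
    have h2 : B v = 0 := hv
    simp [h2] at h1
  have hdim : Module.finrank ℝ E = Module.finrank ℝ (E →L[ℝ] ℝ) := by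
    rw [← (LinearMap.toContinuousLinearMap (𝕜 := ℝ) (E := E) (F' := ℝ)).finrank_eq]
    exact (Subspace.dual_finrank_eq (K := ℝ) (V := E)).symm
  let e := (LinearEquiv.ofInjectiveOfFinrankEq (B : E →ₗ[ℝ] E →L[ℝ] ℝ) hinj
    hdim).toContinuousLinearEquiv
  have he : (e : E →L[ℝ] E →L[ℝ] ℝ) = B := by
    ext v w
    rfl
  have h1 : B (B.inverse α) = α := by
    rw [← he, ContinuousLinearMap.inverse_equiv]
    exact e.apply_symm_apply α
  rw [h1]

theorem inner_grad [FiniteDimensional ℝ E] (g : Metric E M) (f : M → ℝ) (x : M)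
    (ξ : TangentSpace 𝓘(ℝ, E) x) :
    g.inner x (grad g f x) ξ = mfderiv 𝓘(ℝ, E) 𝓘(ℝ, ℝ) f x ξ :=
  apply_inverse (E := E) (g.inner x) (g.pos x) _ ξ

theorem metricInChart_christoffel [FiniteDimensional ℝ E] (g : Metric E M) (x : M) (y : E)
    (hy : y ∈ (extChartAt 𝓘(ℝ, E) x).target) (u v w : E) :
    metricInChart g x y (christoffel g x y u v) w =
      (fderiv ℝ (metricInChart g x) y u v w + fderiv ℝ (metricInChart g x) y v u w
        - fderiv ℝ (metricInChart g x) y w u v) / 2 := by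
  have hpos : ∀ v, v ≠ 0 → 0 < metricInChart g x y v v := by
    intro v hv
    have h1 := g.pos ((extChartAt 𝓘(ℝ, E) x).symm y)
      (mfderiv 𝓘(ℝ, E) 𝓘(ℝ, E) (extChartAt 𝓘(ℝ, E) x).symm y v)
    refine h1 fun h0 => hv ?_
    have hinv := isInvertible_mfderivWithin_extChartAt_symm (I := 𝓘(ℝ, E)) hy
    rw [modelWithCornersSelf_coe, range_id, mfderivWithin_univ] at hinv
    exact hinv.injective (h0.trans (map_zero _).symm)
  unfold christoffel
  rw [apply_inverse _ hpos]
  simp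
  ring

end Riem

/-! ## Shallow networks, their symmetry group and the regular quotient -/

/-- The parameter space `(ℝ × ℝ^d)^m`. -/
abbrev Param (m d : ℕ) := Fin m → ℝ × EuclideanSpace ℝ (Fin d)

/-- The symmetry group `S_m ⋉ (ℝ_{>0})^m`; `S_m` acts on `(ℝ_{>0})^m` by permuting coordinates. -/
abbrev SymGroup (m : ℕ) :=
  (Fin m → {c : ℝ // 0 < c}) ⋊[mulAutArrow (G := Equiv.Perm (Fin m)) (A := Fin m)] Equiv.Perm (Fin m)

/-- The topology of the Lie group `S_m ⋉ (ℝ_{>0})^m`, in which `S_m` is discrete. -/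
instance symGroupTopology (m : ℕ) : TopologicalSpace (SymGroup m) :=
  @TopologicalSpace.induced _ _ (fun g : SymGroup m => (g.left, g.right))
    (@instTopologicalSpaceProd _ _ inferInstance ⊥)

/-- The action of the symmetry group: hidden units are relabelled by the permutation, then the
`i`-th unit `(a, w)` is replaced by `(c_i ^ (-p) a, c_i w)`. -/
def act {m d : ℕ} (p : ℝ) (g : SymGroup m) (θ : Param m d) : Param m d := fun i =>
  (((g.left i : ℝ) ^ (-p)) * (θ (g.right⁻¹ i)).1, (g.left i : ℝ) • (θ (g.right⁻¹ i)).2)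

/-- `act p` is a group action. -/
@[reducible]
def networkAction (m d : ℕ) (p : ℝ) : MulAction (SymGroup m) (Param m d) where
  smul := act p
  one_smul θ := by
    funext i
    change act p 1 θ i = θ i
    ext <;> simp [act]
  mul_smul g h θ := by
    funext i
    change act p (g * h) θ i = act p g (act p h θ) i
    have h1 : ((g * h).left i : ℝ) = g.left i * h.left (g.right⁻¹ i) := rfl
    have h2 : (g * h).right⁻¹ i = h.right⁻¹ (g.right⁻¹ i) := by simp
    unfold act
    rw [h1, h2, Real.mul_rpow (g.left i).2.le (h.left _).2.le, mul_assoc, mul_smul]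

/-- The finite-sample realization map `θ ↦ (f_θ(x_1), …, f_θ(x_n))` of the shallow network
`f_θ(x) = ∑ a_i σ(⟨w_i, x⟩)`. -/
def realization {m d n : ℕ} (σ : ℝ → ℝ) (X : Fin n → EuclideanSpace ℝ (Fin d)) (θ : Param m d) :
    EuclideanSpace ℝ (Fin n) :=
  WithLp.toLp 2 fun k => ∑ i, (θ i).1 * σ (inner ℝ (θ i).2 (X k))

/-- The infinitesimal scaling `ξ ↦ ((-p ξ_i a_i, ξ_i w_i))_i` at `θ`. -/
def infinitesimalAction {m d : ℕ} (p : ℝ) (θ : Param m d) : (Fin m → ℝ) →ₗ[ℝ] Param m d where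
  toFun ξ i := (-p * ξ i * (θ i).1, ξ i • (θ i).2)
  map_add' ξ η := by
    funext i
    ext <;> simp <;> ring
  map_smul' c ξ := by
    funext i
    ext <;> simp <;> ring

/-- The tangent space at `θ` of the orbit of `θ`. -/
def orbitTangent {m d : ℕ} (p : ℝ) (θ : Param m d) : Submodule ℝ (Param m d) :=
  LinearMap.range (infinitesimalAction p θ)

/-- A positively homogeneous activation, a data set, and a regular region `Θ_reg` of the parameter
space: an open invariant set on which the realization map is smooth, the symmetry group acts
properly and locally freely, and the kernel of the differential of the realization map is the
tangent space of the orbit. -/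
structure RegularNetwork (m d n : ℕ) where
  /-- the degree of homogeneity -/
  p : ℝ
  p_pos : 0 < p
  /-- the activation -/
  σ : ℝ → ℝ
  homogeneous : ∀ c t : ℝ, 0 < c → σ (c * t) = c ^ p * σ t
  /-- the data set -/
  X : Fin n → EuclideanSpace ℝ (Fin d)
  /-- the regular region -/
  reg : Opens (Param m d)
  invariant : ∀ (g : SymGroup m) (θ : Param m d), θ ∈ reg → act p g θ ∈ reg
  smooth : ContDiffOn ℝ ∞ (realization σ X : Param m d → EuclideanSpace ℝ (Fin n)) reg
  proper : IsProperMap fun z : SymGroup m × reg =>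
    ((⟨act p z.1 z.2, invariant z.1 z.2 z.2.2⟩, z.2) : reg × reg)
  locallyFree : ∀ θ ∈ reg,
    DiscreteTopology (@MulAction.stabilizer (SymGroup m) (Param m d) _ (networkAction m d p) θ)
  ker_eq : ∀ θ ∈ reg,
    LinearMap.ker (fderiv ℝ (realization σ X : Param m d → EuclideanSpace ℝ (Fin n)) θ
      : Param m d →ₗ[ℝ] EuclideanSpace ℝ (Fin n)) = orbitTangent p θ

namespace RegularNetwork

variable {m d n : ℕ} (N : RegularNetwork m d n)

/-- The realization map of the network on its data set. -/
def Φ (θ : Param m d) : EuclideanSpace ℝ (Fin n) := realization N.σ N.X θ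

/-- Two regular parameters are equivalent if they lie in the same orbit. -/
def orbitSetoid : Setoid N.reg :=
  (@MulAction.orbitRel (SymGroup m) (Param m d) _ (networkAction m d N.p)).comap Subtype.val

/-- The regular quotient `M_reg = Θ_reg / G`. -/
def Quot : Type := Quotient N.orbitSetoid

/-- The quotient topology. -/
instance : TopologicalSpace N.Quot := inferInstanceAs (TopologicalSpace (Quotient N.orbitSetoid))

/-- The quotient map `q : Θ_reg → M_reg`. -/
def q (θ : N.reg) : N.Quot := Quotient.mk N.orbitSetoid θ

/-- The model space of `M_reg`, whose dimension is `m (d + 1) - m`. -/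
abbrev Model (m d : ℕ) := EuclideanSpace ℝ (Fin (m * d))

theorem act_eq_smul (p : ℝ) (g : SymGroup m) (θ : Param m d) :
    (networkAction m d p).toSMul.smul g θ = act p g θ := rfl

theorem q_eq_iff (θ θ' : N.reg) :
    N.q θ = N.q θ' ↔ ∃ g : SymGroup m, act N.p g (θ' : Param m d) = θ :=
  Quotient.eq (r := N.orbitSetoid)

theorem realization_act {σ : ℝ → ℝ} {p : ℝ} (hσ : ∀ c t : ℝ, 0 < c → σ (c * t) = c ^ p * σ t)
    (X : Fin n → EuclideanSpace ℝ (Fin d)) (g : SymGroup m) (θ : Param m d) :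
    realization σ X (act p g θ) = realization σ X θ := by
  ext k
  simp only [realization, act]
  rw [← Equiv.sum_comp (g.right)]
  refine Finset.sum_congr rfl fun i _ => ?_
  have hc := (g.left (g.right i)).2
  rw [real_inner_smul_left, hσ _ _ hc, Real.rpow_neg hc.le]
  have : ((g.left (g.right i) : ℝ)) ^ p ≠ 0 := (Real.rpow_pos_of_pos hc p).ne'
  field_simp
  simp

/-- The descended realization map `M_reg → ℝ^n`. -/
def descended (x : N.Quot) : EuclideanSpace ℝ (Fin n) :=
  Quotient.lift (s := N.orbitSetoid) (fun θ : N.reg => N.Φ θ) (by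
    rintro θ θ' ⟨g, hg⟩
    have hg' : act N.p g (θ' : Param m d) = θ := hg
    simp only [Φ]
    rw [← hg', realization_act N.homogeneous]) x

theorem descended_q (θ : N.reg) : N.descended (N.q θ) = N.Φ θ := rfl

theorem continuous_act (p : ℝ) (g : SymGroup m) :
    Continuous (act p g : Param m d → Param m d) := by
  unfold act
  fun_prop

theorem continuous_q : Continuous N.q := continuous_quotient_mk'

theorem isOpenMap_q : IsOpenMap N.q := by
  intro V hV
  change IsOpen (N.q ⁻¹' (N.q '' V))
  have h : N.q ⁻¹' (N.q '' V) = ⋃ g : SymGroup m,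
      (fun θ : N.reg => (⟨act N.p g θ, N.invariant g θ θ.2⟩ : N.reg)) ⁻¹' V := by
    ext θ
    simp only [mem_preimage, mem_image, mem_iUnion, q_eq_iff]
    constructor
    · rintro ⟨θ', h1, g, h2⟩
      refine ⟨g, ?_⟩
      have : (⟨act N.p g θ, N.invariant g θ θ.2⟩ : N.reg) = θ' := Subtype.ext h2
      rwa [this]
    · rintro ⟨g, hg⟩
      exact ⟨_, hg, g, rfl⟩
  rw [h]
  exact isOpen_iUnion fun g => hV.preimage
    (((continuous_act N.p g).comp continuous_subtype_val).subtype_mk _)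

theorem contDiffAt_Φ {θ : Param m d} (hθ : θ ∈ N.reg) : ContDiffAt ℝ ∞ N.Φ θ :=
  N.smooth.contDiffAt (N.reg.isOpen.mem_nhds hθ)

theorem contMDiff_Φ : ContMDiff 𝓘(ℝ, Param m d) 𝓘(ℝ, EuclideanSpace ℝ (Fin n)) ∞
    (fun θ : N.reg => N.Φ θ) := fun θ =>
  contMDiffAt_subtype_iff.2 (N.contDiffAt_Φ θ.2).contMDiffAt

theorem continuous_descended : Continuous N.descended :=
  N.contMDiff_Φ.continuous.quotient_lift _

/-- The group element with scalings `exp ξ_i`. -/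
def expScale (ξ : Fin m → ℝ) : SymGroup m := ⟨fun i => ⟨Real.exp (ξ i), Real.exp_pos _⟩, 1⟩

theorem act_expScale (p : ℝ) (ξ : Fin m → ℝ) (θ : Param m d) : act p (expScale ξ) θ =
    fun i => (Real.exp (-p * ξ i) * (θ i).1, Real.exp (ξ i) • (θ i).2) := by
  funext i
  simp only [act, expScale]
  rw [← Real.exp_mul, mul_comm (ξ i)]
  simp

theorem continuous_expScale : Continuous (expScale : (Fin m → ℝ) → SymGroup m) := by
  refine continuous_induced_rng.2 ?_
  let _ : TopologicalSpace (Equiv.Perm (Fin m)) := ⊥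
  refine Continuous.prodMk ?_ continuous_const
  exact continuous_pi fun i => (Real.continuous_exp.comp (continuous_apply i)).subtype_mk _

theorem unit_ne_zero {θ : Param m d} (hθ : θ ∈ N.reg) (i : Fin m) : θ i ≠ 0 := by
  intro h0
  have hd := N.locallyFree θ hθ
  have hstab : ∀ t : ℝ, act N.p (expScale (Pi.single i t)) θ = θ := by
    intro t
    rw [act_expScale]
    funext j
    by_cases hj : j = i
    · subst hj
      simp [h0]
    · simp [Pi.single_eq_of_ne hj]
  let f : ℝ → @MulAction.stabilizer (SymGroup m) (Param m d) _ (networkAction m d N.p) θ :=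
    fun t => ⟨expScale (Pi.single i t), hstab t⟩
  have hf : Continuous f :=
    (continuous_expScale.comp (continuous_single i)).subtype_mk _
  have ho : IsOpen (f ⁻¹' {f 0}) := (isOpen_discrete _).preimage hf
  have hs : f ⁻¹' {f 0} = {0} := by
    ext t
    simp only [mem_preimage, mem_singleton_iff]
    constructor
    · intro h
      have h1 := congrArg (fun g : SymGroup m => (g.left i : ℝ)) (congrArg Subtype.val h)
      simpa [f, expScale] using h1
    · rintro rfl
      rfl
  rw [hs] at ho
  exact not_isOpen_singleton (0 : ℝ) ho

theorem infinitesimalAction_injective {θ : Param m d} (hθ : θ ∈ N.reg) :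
    Function.Injective (infinitesimalAction N.p θ) := by
  rw [injective_iff_map_eq_zero]
  intro ξ hξ
  funext i
  by_contra hi
  refine N.unit_ne_zero hθ i ?_
  have h1 := congrFun hξ i
  have h2 := congrArg Prod.fst h1
  have h3 := congrArg Prod.snd h1
  simp only [infinitesimalAction, LinearMap.coe_mk, AddHom.coe_mk, Pi.zero_apply, Prod.fst_zero,
    Prod.snd_zero, mul_eq_zero, smul_eq_zero, neg_eq_zero, N.p_pos.ne', false_or] at h2 h3
  exact Prod.ext (h2.resolve_left hi) (h3.resolve_left hi)

theorem finrank_param : Module.finrank ℝ (Param m d) = m * d + m := by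
  simp [Param, Module.finrank_pi_fintype, Module.finrank_prod]
  ring

theorem mem_ker_iff {θ : Param m d} (hθ : θ ∈ N.reg) (u : Param m d) :
    fderiv ℝ N.Φ θ u = 0 ↔ ∃ ξ, infinitesimalAction N.p θ ξ = u := by
  have h := N.ker_eq θ hθ
  rw [SetLike.ext_iff] at h
  exact h u

theorem hasStrictFDerivAt_act (p : ℝ) (L : Model m d →L[ℝ] Param m d) (θ₀ : Param m d)
    (y : Model m d) :
    HasStrictFDerivAt (fun z : (Fin m → ℝ) × Model m d => act p (expScale z.1) (θ₀ + L z.2))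
      ((infinitesimalAction p (θ₀ + L y)).toContinuousLinearMap.coprod L) (0, y) := by
  have h1 : ContDiff ℝ ∞
      (fun z : (Fin m → ℝ) × Model m d => act p (expScale z.1) (θ₀ + L z.2)) := by
    simp only [act_expScale]
    fun_prop
  have h2 := h1.contDiffAt (x := ((0 : Fin m → ℝ), y)) |>.hasStrictFDerivAt (by simp)
  convert! h2 using 1
  symm
  have h3 : HasFDerivAt
      (fun z : (Fin m → ℝ) × Model m d => act p (expScale z.1) (θ₀ + L z.2))
      ((infinitesimalAction p (θ₀ + L y)).toContinuousLinearMap.coprod L) (0, y) := by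
    simp only [act_expScale]
    rw [hasFDerivAt_pi']
    intro i
    have hξ : HasFDerivAt (fun z : (Fin m → ℝ) × Model m d => z.1 i)
        ((ContinuousLinearMap.proj (R := ℝ) i).comp
          (ContinuousLinearMap.fst ℝ (Fin m → ℝ) (Model m d))) (0, y) :=
      ((ContinuousLinearMap.proj (R := ℝ) i).comp
        (ContinuousLinearMap.fst ℝ (Fin m → ℝ) (Model m d))).hasFDerivAt
    have hθ : HasFDerivAt (fun z : (Fin m → ℝ) × Model m d => (θ₀ + L z.2) i)
        ((ContinuousLinearMap.proj (R := ℝ) i).comp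
          (L.comp (ContinuousLinearMap.snd ℝ (Fin m → ℝ) (Model m d)))) (0, y) :=
      ((ContinuousLinearMap.hasFDerivAt
        ((ContinuousLinearMap.proj (R := ℝ) i).comp
          (L.comp (ContinuousLinearMap.snd ℝ (Fin m → ℝ) (Model m d))))).const_add (θ₀ i))
    have ha := (hξ.const_mul (-p)).exp.mul hθ.fst
    have hw := hξ.exp.smul hθ.snd
    convert! ha.prodMk hw using 1
    ext z <;> simp [infinitesimalAction] <;> ring
  exact h3.fderiv

/-- `φ` is a smooth chart of `M_reg`: the quotient map is smooth in the chart `φ`, and the inverse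
of `φ` lifts locally to a smooth map into `Θ_reg`. In other words, the quotient map is a smooth
submersion in the chart `φ`. -/
structure IsSmoothChart (φ : OpenPartialHomeomorph N.Quot (Model m d)) : Prop where
  contMDiffOn : ContMDiffOn 𝓘(ℝ, Param m d) 𝓘(ℝ, Model m d) ∞ (fun θ : N.reg => φ (N.q θ))
    (N.q ⁻¹' φ.source)
  exists_lift : ∀ y ∈ φ.target, ∃ s : Model m d → N.reg,
    ContMDiffAt 𝓘(ℝ, Model m d) 𝓘(ℝ, Param m d) ∞ s y ∧ ∀ᶠ z in 𝓝 y, N.q (s z) = φ.symm z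

theorem exists_slice {θ₀ : Param m d} (hθ₀ : θ₀ ∈ N.reg) :
    ∃ (L : Model m d →L[ℝ] Param m d) (A : EuclideanSpace ℝ (Fin n) →L[ℝ] Model m d),
      A ∘L (fderiv ℝ N.Φ θ₀) ∘L L = ContinuousLinearMap.id ℝ (Model m d) := by
  obtain ⟨H, hH⟩ := Submodule.exists_isCompl (orbitTangent N.p θ₀)
  have h1 : Module.finrank ℝ (orbitTangent N.p θ₀) = m := by
    rw [orbitTangent, LinearMap.finrank_range_of_inj (N.infinitesimalAction_injective hθ₀)]
    simp
  have h2 : Module.finrank ℝ (Model m d) = Module.finrank ℝ H := by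
    have h3 := Submodule.finrank_add_eq_of_isCompl hH
    rw [finrank_param, h1] at h3
    simp only [finrank_euclideanSpace, Fintype.card_fin]
    omega
  let e := LinearEquiv.ofFinrankEq (Model m d) H h2
  let L : Model m d →ₗ[ℝ] Param m d := H.subtype ∘ₗ e.toLinearMap
  let D : Model m d →ₗ[ℝ] EuclideanSpace ℝ (Fin n) := (fderiv ℝ N.Φ θ₀).toLinearMap ∘ₗ L
  have hD : LinearMap.ker D = ⊥ := by
    rw [LinearMap.ker_eq_bot']
    intro v hv
    have h4 : L v ∈ orbitTangent N.p θ₀ := (N.mem_ker_iff hθ₀ _).1 hv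
    have h5 : L v ∈ H := (e v).2
    have h6 : L v = 0 := by
      have := hH.disjoint.le_bot (Submodule.mem_inf.2 ⟨h4, h5⟩)
      simpa using this
    have h7 : e v = 0 := Subtype.ext h6
    simpa using h7
  obtain ⟨A, hA⟩ := LinearMap.exists_leftInverse_of_injective D hD
  refine ⟨L.toContinuousLinearMap, A.toContinuousLinearMap, ?_⟩
  ext1 v
  exact LinearMap.congr_fun hA v

theorem exists_chart (x : N.Quot) : ∃ φ : OpenPartialHomeomorph N.Quot (Model m d),
    N.IsSmoothChart φ ∧ x ∈ φ.source ∧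
    ∃ A : EuclideanSpace ℝ (Fin n) →L[ℝ] Model m d, ∀ z ∈ φ.source, φ z = A (N.descended z) := by
  obtain ⟨θ₀, rfl⟩ : ∃ θ, N.q θ = x := Quotient.exists_rep x
  obtain ⟨L, A, hAL⟩ := N.exists_slice θ₀.2
  let S : Model m d → Param m d := fun y => θ₀ + L y
  have hS : ContDiff ℝ ∞ S := by fun_prop
  have hS0 : S 0 = θ₀ := by simp [S]
  have hSd : ∀ y, HasFDerivAt S L y := fun y => L.hasFDerivAt.const_add _
  let h : Model m d → Model m d := fun y => A (N.Φ (S y))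
  let W : Set (Model m d) := S ⁻¹' N.reg
  have hW : IsOpen W := N.reg.isOpen.preimage hS.continuous
  have hW0 : (0 : Model m d) ∈ W := by
    change S 0 ∈ N.reg
    rw [hS0]
    exact θ₀.2
  have hhC : ∀ y ∈ W, ContDiffAt ℝ ∞ h y := fun y hy =>
    A.contDiff.contDiffAt.comp y ((N.contDiffAt_Φ hy).comp y hS.contDiffAt)
  have hhd : ∀ y ∈ W, HasFDerivAt h (A ∘L (fderiv ℝ N.Φ (S y)) ∘L L) y := fun y hy =>
    A.hasFDerivAt.comp y
      ((((N.contDiffAt_Φ hy).differentiableAt (by simp)).hasFDerivAt).comp y (hSd y))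
  have hh0 : HasFDerivAt h
      ((ContinuousLinearEquiv.refl ℝ (Model m d) : Model m d →L[ℝ] Model m d)) 0 := by
    have := hhd 0 hW0
    rw [hS0, hAL] at this
    exact this
  let hh := (hhC 0 hW0).toOpenPartialHomeomorph h hh0 (by simp)
  have hhcoe : ∀ y, hh y = h y := fun y => rfl
  have hh0s : (0 : Model m d) ∈ hh.source :=
    (hhC 0 hW0).mem_toOpenPartialHomeomorph_source hh0 (by simp)
  let R : Set (Model m d →L[ℝ] Model m d) :=
    range ((↑) : (Model m d ≃L[ℝ] Model m d) → (Model m d →L[ℝ] Model m d))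
  have hR : IsOpen R := ContinuousLinearEquiv.isOpen
  have hdc : ContinuousOn (fun y => A ∘L (fderiv ℝ N.Φ (S y)) ∘L L) W := by
    intro y hy
    have h1 : ContinuousAt (fderiv ℝ N.Φ) (S y) :=
      ((N.contDiffAt_Φ hy).fderiv_right (m := 0) (by simp)).continuousAt
    have h2 : ContinuousAt (fun y => fderiv ℝ N.Φ (S y)) y := h1.comp hS.continuous.continuousAt
    exact (continuousAt_const.clm_comp (h2.clm_comp continuousAt_const)).continuousWithinAt
  let B : Set (Model m d) := hh.source ∩ (W ∩ (fun y => A ∘L (fderiv ℝ N.Φ (S y)) ∘L L) ⁻¹' R)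
  have hB : IsOpen B := hh.open_source.inter (hdc.isOpen_inter_preimage hW hR)
  have hB0 : (0 : Model m d) ∈ B := by
    refine ⟨hh0s, hW0, ?_⟩
    change A ∘L (fderiv ℝ N.Φ (S 0)) ∘L L ∈ R
    rw [hS0, hAL]
    exact ⟨ContinuousLinearEquiv.refl ℝ _, rfl⟩
  have hBW : ∀ y ∈ B, S y ∈ N.reg := fun y hy => hy.2.1
  classical
  let T : Model m d → N.reg := fun y => if hy : S y ∈ N.reg then ⟨S y, hy⟩ else θ₀
  have hT : ∀ y ∈ W, (T y : Param m d) = S y := fun y hy => by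
    have hy' : S y ∈ N.reg := hy
    simp [T, hy']
  have hTC : ∀ y ∈ W, ContMDiffAt 𝓘(ℝ, Model m d) 𝓘(ℝ, Param m d) ∞ T y := by
    intro y hy
    rw [← ContMDiffAt.subtypeVal_comp_iff]
    refine hS.contDiffAt.contMDiffAt.congr_of_eventuallyEq ?_
    filter_upwards [hW.mem_nhds hy] with z hz using hT z hz
  have hAT : ∀ y ∈ W, A (N.descended (N.q (T y))) = h y := fun y hy => by
    rw [descended_q, hT y hy]
  -- the image of the slice is open in the quotient
  have hopen : IsOpen (N.q '' (T '' B)) := by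
    rw [isOpen_iff_mem_nhds]
    rintro _ ⟨_, ⟨y, hy, rfl⟩, rfl⟩
    have hyW : y ∈ W := hy.2.1
    have hder := hasStrictFDerivAt_act N.p L (θ₀ : Param m d) y
    have hsurj : LinearMap.range
        ((infinitesimalAction N.p ((θ₀ : Param m d) + L y)).toContinuousLinearMap.coprod L
          : (Fin m → ℝ) × Model m d →ₗ[ℝ] Param m d) = ⊤ := by
      rw [← LinearMap.ker_eq_bot_iff_range_eq_top_of_finrank_eq_finrank]
      · rw [LinearMap.ker_eq_bot']
        rintro ⟨ξ, v⟩ hv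
        have hv1 : infinitesimalAction N.p (S y) ξ + L v = 0 := hv
        have hk : fderiv ℝ N.Φ (S y) (L v) = 0 := by
          rw [N.mem_ker_iff hyW]
          refine ⟨-ξ, ?_⟩
          rw [map_neg]
          exact neg_eq_of_add_eq_zero_right hv1
        obtain ⟨e, he⟩ := hy.2.2
        have hv0 : v = 0 := by
          have h1 : e v = A (fderiv ℝ N.Φ (S y) (L v)) := DFunLike.congr_fun he v
          rw [hk, map_zero] at h1
          simpa using h1
        subst hv0
        have hξ : ξ = 0 := N.infinitesimalAction_injective hyW (by simpa using hv1)
        simp [hξ]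
      · rw [finrank_param, Module.finrank_prod]
        simp
        ring
    have hmap := hder.map_nhds_eq_of_surj hsurj
    have hpt : act N.p (expScale 0) ((θ₀ : Param m d) + L y) = T y := by
      rw [hT y hyW, act_expScale]
      funext i
      simp [S]
      rfl
    have hnb : {z : (Fin m → ℝ) × Model m d | z.2 ∈ B} ∈ 𝓝 ((0 : Fin m → ℝ), y) :=
      continuous_snd.continuousAt.preimage_mem_nhds (hB.mem_nhds hy)
    have him := image_mem_map
      (m := fun z : (Fin m → ℝ) × Model m d => act N.p (expScale z.1) ((θ₀ : Param m d) + L z.2)) hnb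
    rw [hmap] at him
    simp only [hpt] at him
    have him2 := (continuous_subtype_val.continuousAt (x := T y)).preimage_mem_nhds him
    have him3 := N.isOpenMap_q.image_mem_nhds him2
    refine mem_of_superset him3 ?_
    rintro _ ⟨θ, ⟨z, hz, hzθ⟩, rfl⟩
    refine ⟨T z.2, ⟨z.2, hz, rfl⟩, ?_⟩
    symm
    rw [q_eq_iff]
    refine ⟨expScale z.1, ?_⟩
    rw [hT z.2 hz.2.1]
    exact hzθ
  have hBh : ∀ y ∈ B, hh.symm (h y) = y := fun y hy => hh.left_inv hy.1
  let φ : OpenPartialHomeomorph N.Quot (Model m d) :=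
    { toFun := fun z => A (N.descended z)
      invFun := fun z => N.q (T (hh.symm z))
      source := N.q '' (T '' B)
      target := hh '' B
      map_source' := by
        rintro _ ⟨_, ⟨y, hy, rfl⟩, rfl⟩
        exact ⟨y, hy, (hAT y hy.2.1).symm⟩
      map_target' := by
        rintro _ ⟨y, hy, rfl⟩
        refine ⟨_, ⟨y, hy, rfl⟩, ?_⟩
        rw [hhcoe, hBh y hy]
      left_inv' := by
        rintro _ ⟨_, ⟨y, hy, rfl⟩, rfl⟩
        simp only [hAT y hy.2.1, hBh y hy]
      right_inv' := by
        rintro _ ⟨y, hy, rfl⟩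
        simp only [hhcoe, hBh y hy, hAT y hy.2.1]
      open_source := hopen
      open_target := hh.isOpen_image_of_subset_source hB inter_subset_left
      continuousOn_toFun := (A.continuous.comp N.continuous_descended).continuousOn
      continuousOn_invFun := by
        rintro _ ⟨y, hy, rfl⟩
        have h1 : ContinuousAt hh.symm (hh y) := hh.continuousAt_symm (hh.map_source hy.1)
        have h2 : ContinuousAt T (hh.symm (hh y)) := by
          rw [hhcoe, hBh y hy]
          exact (hTC y hy.2.1).continuousAt
        exact (N.continuous_q.continuousAt.comp (h2.comp h1)).continuousWithinAt }
  refine ⟨φ, ⟨?_, ?_⟩, ⟨T 0, ⟨0, hB0, rfl⟩, ?_⟩, A, fun z _ => rfl⟩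
  · exact (A.contDiff.contMDiff.comp N.contMDiff_Φ).contMDiffOn
  · rintro _ ⟨y, hy, rfl⟩
    refine ⟨fun z => T (hh.symm z), ?_, Eventually.of_forall fun z => rfl⟩
    obtain ⟨e, he⟩ := hy.2.2
    have hleft : hh.symm (hh y) = y := hBh y hy
    have h1 : ContDiffAt ℝ ∞ hh.symm (hh y) := by
      refine hh.contDiffAt_symm (f₀' := e) (hh.map_source hy.1) ?_ ?_
      · rw [hleft]
        have h2 := hhd y hy.2.1
        have he' : (e : Model m d →L[ℝ] Model m d) = A ∘L (fderiv ℝ N.Φ (S y)) ∘L L := he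
        rw [← he'] at h2
        exact h2
      · rw [hleft]
        exact hhC y hy.2.1
    have h3 : ContMDiffAt 𝓘(ℝ, Model m d) 𝓘(ℝ, Param m d) ∞ T (hh.symm (hh y)) := by
      rw [hleft]
      exact hTC y hy.2.1
    exact h3.comp _ h1.contMDiffAt
  · congr 1
    exact Subtype.ext ((hT 0 hW0).trans hS0)

/-- The smooth structure of `M_reg`: its charts are all those in which the quotient map is a smooth
submersion. -/
instance : ChartedSpace (Model m d) N.Quot where
  atlas := {φ | N.IsSmoothChart φ}
  chartAt x := (N.exists_chart x).choose
  mem_chart_source x := (N.exists_chart x).choose_spec.2.1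
  chart_mem_atlas x := (N.exists_chart x).choose_spec.1

instance : IsManifold 𝓘(ℝ, Model m d) ∞ N.Quot := by
  refine isManifold_of_contDiffOn _ _ _ fun e e' he he' => ?_
  intro y hy
  simp only [modelWithCornersSelf_coe, modelWithCornersSelf_coe_symm, range_id, inter_univ,
    preimage_id, Function.comp_id, Function.id_comp] at hy ⊢
  have hy' : y ∈ e.target ∧ e.symm y ∈ e'.source := by simpa using hy
  obtain ⟨s, hs, hse⟩ := (he : N.IsSmoothChart e).exists_lift y hy'.1
  have h1 : N.q (s y) = e.symm y := hse.self_of_nhds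
  have h2 : ContMDiffAt 𝓘(ℝ, Param m d) 𝓘(ℝ, Model m d) ∞ (fun θ : N.reg => e' (N.q θ)) (s y) :=
    (he' : N.IsSmoothChart e').contMDiffOn.contMDiffAt
      ((e'.open_source.preimage N.continuous_q).mem_nhds (by
        change N.q (s y) ∈ e'.source
        rw [h1]
        exact hy'.2))
  have h3 := (h2.comp y hs).contDiffAt
  refine (h3.congr_of_eventuallyEq ?_).contDiffWithinAt
  filter_upwards [hse] with z hz
  simp [hz]

theorem contMDiff_q : ContMDiff 𝓘(ℝ, Param m d) 𝓘(ℝ, Model m d) ∞ N.q := by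
  intro θ
  rw [contMDiffAt_iff_target]
  refine ⟨N.continuous_q.continuousAt, ?_⟩
  have h := (show N.IsSmoothChart (chartAt (Model m d) (N.q θ)) from
    (N.exists_chart (N.q θ)).choose_spec.1).contMDiffOn
  exact h.contMDiffAt
    (((chartAt (Model m d) (N.q θ)).open_source.preimage N.continuous_q).mem_nhds
      (mem_chart_source _ _))

theorem contMDiff_descended :
    ContMDiff 𝓘(ℝ, Model m d) 𝓘(ℝ, EuclideanSpace ℝ (Fin n)) ∞ N.descended := by
  intro x
  obtain ⟨s, hs, hse⟩ := (show N.IsSmoothChart (chartAt (Model m d) x) from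
    (N.exists_chart x).choose_spec.1).exists_lift _ (mem_chart_target (Model m d) x)
  have h1 : ContMDiffAt 𝓘(ℝ, Model m d) 𝓘(ℝ, Model m d) ∞ (chartAt (Model m d) x) x :=
    contMDiffOn_chart.contMDiffAt
      ((chartAt (Model m d) x).open_source.mem_nhds (mem_chart_source _ _))
  have h2 := (N.contMDiff_Φ.contMDiffAt.comp _ hs).comp x h1
  refine h2.congr_of_eventuallyEq ?_
  have h3 := ((chartAt (Model m d) x).continuousAt (mem_chart_source _ x)).eventually hse
  filter_upwards [h3, (chartAt (Model m d) x).open_source.mem_nhds (mem_chart_source _ x)]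
    with z hz hzs
  have h4 : N.q (s (chartAt (Model m d) x z)) = z := by
    rw [hz, (chartAt (Model m d) x).left_inv hzs]
  simp only [Function.comp]
  rw [← descended_q, h4]

theorem mfderiv_descended_injective (x : N.Quot) : Function.Injective
    (mfderiv 𝓘(ℝ, Model m d) 𝓘(ℝ, EuclideanSpace ℝ (Fin n)) N.descended x) := by
  obtain ⟨A, hA⟩ := (N.exists_chart x).choose_spec.2.2
  have hinv := isInvertible_mfderiv_extChartAt (I := 𝓘(ℝ, Model m d)) (mem_extChartAt_source x)
  have h1 : HasMFDerivAt 𝓘(ℝ, Model m d) 𝓘(ℝ, Model m d) (fun z => A (N.descended z)) x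
      (A ∘L (mfderiv 𝓘(ℝ, Model m d) 𝓘(ℝ, EuclideanSpace ℝ (Fin n)) N.descended x)) :=
    A.hasFDerivAt.hasMFDerivAt.comp x
      (N.contMDiff_descended.contMDiffAt.mdifferentiableAt (by simp)).hasMFDerivAt
  have h2 : (extChartAt 𝓘(ℝ, Model m d) x : N.Quot → Model m d) =ᶠ[𝓝 x]
      fun z => A (N.descended z) := by
    filter_upwards [(chartAt (Model m d) x).open_source.mem_nhds (mem_chart_source _ x)] with z hz
    exact hA z hz
  rw [h2.mfderiv_eq, h1.mfderiv] at hinv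
  exact Function.Injective.of_comp (f := A) hinv.injective

/-- The pullback form `g_θ(u, v) = (1/n) ⟨DΦ(θ) u, DΦ(θ) v⟩` on the parameter space. -/
def pullbackForm (θ u v : Param m d) : ℝ :=
  (1 / n : ℝ) * inner ℝ (fderiv ℝ N.Φ θ u) (fderiv ℝ N.Φ θ v)

theorem metric_pos (x : N.Quot) (v : TangentSpace 𝓘(ℝ, Model m d) x) (hv : v ≠ 0) :
    0 < (1 / n : ℝ) * inner ℝ
      ((mfderiv 𝓘(ℝ, Model m d) 𝓘(ℝ, EuclideanSpace ℝ (Fin n)) N.descended x v :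
        EuclideanSpace ℝ (Fin n)))
      ((mfderiv 𝓘(ℝ, Model m d) 𝓘(ℝ, EuclideanSpace ℝ (Fin n)) N.descended x v :
        EuclideanSpace ℝ (Fin n))) := by
  have h1 : (mfderiv 𝓘(ℝ, Model m d) 𝓘(ℝ, EuclideanSpace ℝ (Fin n)) N.descended x v :
      EuclideanSpace ℝ (Fin n)) ≠ 0 := fun h0 =>
    hv (N.mfderiv_descended_injective x (h0.trans (map_zero _).symm))
  have hn : 0 < n := by
    rcases Nat.eq_zero_or_pos n with h0 | hn
    · subst h0
      exact absurd (Subsingleton.elim (α := EuclideanSpace ℝ (Fin 0)) _ _) h1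
    · exact hn
  have hn' : (0 : ℝ) < n := by exact_mod_cast hn
  exact mul_pos (by positivity) (real_inner_self_pos.2 h1)

theorem hasMFDerivAt_Φ (θ : N.reg) :
    HasMFDerivAt 𝓘(ℝ, Param m d) 𝓘(ℝ, EuclideanSpace ℝ (Fin n)) (fun θ : N.reg => N.Φ θ) θ
      (fderiv ℝ N.Φ (θ : Param m d) : Param m d →L[ℝ] EuclideanSpace ℝ (Fin n)) := by
  refine ⟨N.contMDiff_Φ.continuous.continuousAt, ?_⟩
  have h1 := ((N.contDiffAt_Φ θ.2).differentiableAt (by simp)).hasFDerivAt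
  refine HasFDerivAt.hasFDerivWithinAt ?_
  refine HasFDerivAt.congr_of_eventuallyEq (f := N.Φ) h1 ?_
  have h2 : ∀ᶠ z in 𝓝 (extChartAt 𝓘(ℝ, Param m d) θ θ),
      z ∈ (extChartAt 𝓘(ℝ, Param m d) θ).target :=
    extChartAt_target_mem_nhds θ
  filter_upwards [h2] with z hz
  have h3 : (((extChartAt 𝓘(ℝ, Param m d) θ).symm z : N.reg) : Param m d) = z :=
    (extChartAt 𝓘(ℝ, Param m d) θ).right_inv hz
  simp only [writtenInExtChartAt, extChartAt_model_space_eq_id, Function.comp,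
    PartialEquiv.refl_coe, id]
  rw [h3]

/-- The bilinear form `(ξ, η) ↦ (1/n) ⟨DΦ̄(x) ξ, DΦ̄(x) η⟩` on the tangent space of `M_reg` at `x`,
with `Φ̄` the descended realization map. -/
def metricInner (x : N.Quot) :
    TangentSpace 𝓘(ℝ, Model m d) x →L[ℝ] TangentSpace 𝓘(ℝ, Model m d) x →L[ℝ] ℝ :=
  (1 / n : ℝ) • ContinuousLinearMap.bilinearComp (E' := Model m d) (F' := Model m d)
    (innerSL ℝ (E := EuclideanSpace ℝ (Fin n)))
    (mfderiv 𝓘(ℝ, Model m d) 𝓘(ℝ, EuclideanSpace ℝ (Fin n)) N.descended x)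
    (mfderiv 𝓘(ℝ, Model m d) 𝓘(ℝ, EuclideanSpace ℝ (Fin n)) N.descended x)

/-- The quotient metric on `M_reg`, the Riemannian metric induced by the pullback form
(see `metric_q`). -/
def metric : Riem.Metric (Model m d) N.Quot where
  inner x := N.metricInner x
  symm x v w := by
    exact congrArg ((1 / n : ℝ) * ·) (real_inner_comm (F := EuclideanSpace ℝ (Fin n)) _ _)
  pos x v hv := N.metric_pos x v hv
  isVonNBounded x := by
    have hinj := N.mfderiv_descended_injective x
    let D : Model m d →ₗ[ℝ] EuclideanSpace ℝ (Fin n) :=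
      (mfderiv 𝓘(ℝ, Model m d) 𝓘(ℝ, EuclideanSpace ℝ (Fin n)) N.descended x).toLinearMap
    obtain ⟨K, hK, hD⟩ := (LinearMap.injective_iff_antilipschitz D).1 hinj
    change Bornology.IsVonNBounded ℝ {v : Model m d | (1 / n : ℝ) * inner ℝ (D v) (D v) < 1}
    rw [NormedSpace.isVonNBounded_iff, isBounded_iff_forall_norm_le]
    refine ⟨K * (n + 1), fun v hv => ?_⟩
    have h1 : ‖v‖ ≤ K * ‖D v‖ := by simpa using hD.le_mul_dist v 0
    refine h1.trans (mul_le_mul_of_nonneg_left ?_ K.2)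
    rcases Nat.eq_zero_or_pos n with h0 | hn
    · subst h0
      have : D v = 0 := Subsingleton.elim _ _
      simp [this]
    · have hn' : (0 : ℝ) < n := by exact_mod_cast hn
      have h2 : (1 / n : ℝ) * inner ℝ (D v) (D v) < 1 := hv
      rw [real_inner_self_eq_norm_sq, div_mul_eq_mul_div, one_mul, div_lt_one hn'] at h2
      nlinarith [norm_nonneg (D v)]
  contMDiff := by
    intro x₀
    rw [Bundle.contMDiffAt_section]
    have hA := (N.contMDiff_descended.contMDiffAt (x := x₀)).mfderiv_const (m := ∞) (by simp)
    let P : (Model m d →L[ℝ] EuclideanSpace ℝ (Fin n)) → (Model m d →L[ℝ] Model m d →L[ℝ] ℝ) :=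
      fun D => (1 / n : ℝ) • ContinuousLinearMap.bilinearComp
        (innerSL ℝ (E := EuclideanSpace ℝ (Fin n))) D D
    have hP : ContDiff ℝ ∞ P := by
      refine contDiff_clm_apply_iff.2 fun v => contDiff_clm_apply_iff.2 fun w => ?_
      change ContDiff ℝ ∞ fun D : Model m d →L[ℝ] EuclideanSpace ℝ (Fin n) =>
        (1 / n : ℝ) * inner ℝ (D v) (D w)
      exact contDiff_const.mul
        ((contDiff_id.clm_apply contDiff_const).inner ℝ (contDiff_id.clm_apply contDiff_const))
    have h := hP.contDiffAt.contMDiffAt.comp x₀ hA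
    refine h.congr_of_eventuallyEq ?_
    filter_upwards [(chartAt (Model m d) x₀).open_source.mem_nhds (mem_chart_source _ x₀)] with x hx
    rw [hom_trivializationAt_apply]
    ext v w
    have hb : x ∈ (trivializationAt (Model m d →L[ℝ] ℝ)
        (fun x : N.Quot => TangentSpace 𝓘(ℝ, Model m d) x →L[ℝ] ℝ) x₀).baseSet := by
      rw [hom_trivializationAt_baseSet]
      exact ⟨by simpa using hx, by simp⟩
    simp [ContinuousLinearMap.inCoordinates, inTangentCoordinates, P]
    have hl : ∀ ψ : TangentSpace 𝓘(ℝ, Model m d) x →L[ℝ] ℝ,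
        (Bundle.Trivialization.linearMapAt ℝ (trivializationAt (Model m d →L[ℝ] ℝ)
          (fun x : N.Quot => TangentSpace 𝓘(ℝ, Model m d) x →L[ℝ] ℝ) x₀) x) ψ w =
        ψ (Bundle.Trivialization.symmL ℝ
          (trivializationAt (Model m d) (TangentSpace 𝓘(ℝ, Model m d)) x₀) x w) := by
      intro ψ
      rw [Bundle.Trivialization.coe_linearMapAt_of_mem _ hb]
      simp [hom_trivializationAt_apply, ContinuousLinearMap.inCoordinates]
    rw [hl, ← one_div]
    rfl

/-- The quotient metric satisfies `ḡ(Dq u, Dq v) = g_θ(u, v)`. -/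
theorem metric_q (θ : N.reg) (u v : Param m d) :
    N.metric.inner (N.q θ) (mfderiv 𝓘(ℝ, Param m d) 𝓘(ℝ, Model m d) N.q θ u)
      (mfderiv 𝓘(ℝ, Param m d) 𝓘(ℝ, Model m d) N.q θ v) = N.pullbackForm θ u v := by
  have h1 := ((N.contMDiff_descended.contMDiffAt (x := N.q θ)).mdifferentiableAt
    (by simp)).hasMFDerivAt
  have h2 := ((N.contMDiff_q.contMDiffAt (x := θ)).mdifferentiableAt (by simp)).hasMFDerivAt
  have h3 := hasMFDerivAt_unique (h1.comp θ h2) (N.hasMFDerivAt_Φ θ)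
  have h4 : ∀ u : Param m d, mfderiv 𝓘(ℝ, Model m d) 𝓘(ℝ, EuclideanSpace ℝ (Fin n)) N.descended
      (N.q θ) (mfderiv 𝓘(ℝ, Param m d) 𝓘(ℝ, Model m d) N.q θ u) = fderiv ℝ N.Φ θ u :=
    fun u => DFunLike.congr_fun h3 u
  unfold pullbackForm
  rw [← h4 u, ← h4 v]
  rfl

end RegularNetwork

end

/-! The argument takes place on a finite-dimensional Riemannian manifold; networks enter only
through the manifold and metric already constructed on the quotient. Along a geodesic `c`, the
function `f ∘ c` has second derivative `Hess f (c', c')`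
(`IsGeodesicOn.hasDerivWithinAt_mfderiv_velocity`), and the squared speed is constant
(`IsGeodesicOn.hasDerivWithinAt_inner_velocity`). The lower Hessian bound therefore bounds `(f ∘
c)''` below by the constant `μ |v|²`, where `v` is the initial velocity. Taylor expansion on `[0,
1]` gives `f(x) + ⟨grad f(x), v⟩ + μ |v|² / 2 ≤ f(y)` for all `x, y` in `U`
(`IsGeodesicOn.add_le_of_hessian_ge`).

Everything about minimizers and the flow follows from this inequality. At a critical point the
linear term vanishes, which gives minimality; equality forces `v = 0`, hence a constant geodesic,
which gives uniqueness. Completing the square in `v` gives the Polyak–Łojasiewicz inequality `2μ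
(f(x) - f(y)) ≤ |grad f(x)|²` (`two_mul_sub_le_inner_grad`). Since `f` decreases along the flow at
rate `|grad f|²`, Grönwall's argument gives the exponential rate. The eigenvalue bounds come from
dividing the Hessian bounds by `g(ξ, ξ) > 0`. -/

namespace Riem

/-! ### Velocities of curves and chain rules in charts -/

variable {E : Type*} [NormedAddCommGroup E] [NormedSpace ℝ E]
  {M : Type*} [TopologicalSpace M] [ChartedSpace E M]

/-- The velocity at time `t` of a curve `c` defined on `s`. -/
noncomputable def velocity (c : ℝ → M) (s : Set ℝ) (t : ℝ) : TangentSpace 𝓘(ℝ, E) (c t) :=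
  mfderivWithin 𝓘(ℝ, ℝ) 𝓘(ℝ, E) c s t (1 : ℝ)

/-- Stated for plain normed spaces, so that a manifold derivative can be evaluated at `1` with its
tangent spaces read as the model space. -/
theorem hasDerivWithinAt_of_hasFDerivWithinAt_comp {F : Type*} [NormedAddCommGroup F]
    [NormedSpace ℝ F] {A : E →L[ℝ] F} {B : ℝ →L[ℝ] E} {f : ℝ → F} {s : Set ℝ} {t : ℝ}
    (h : HasFDerivWithinAt f (A.comp B) s t) : HasDerivWithinAt f (A (B 1)) s t :=
  h.hasDerivWithinAt

theorem hasDerivWithinAt_comp_differentiableAt {W : Type*} [NormedAddCommGroup W]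
    [NormedSpace ℝ W] {G : E → W} {u : ℝ → E} {s : Set ℝ} {t : ℝ} {u' : E}
    (hG : DifferentiableAt ℝ G (u t)) (hu : HasDerivWithinAt u u' s t) :
    HasDerivWithinAt (fun r => G (u r)) (fderiv ℝ G (u t) u') s t :=
  hG.hasFDerivAt.comp_hasDerivWithinAt t hu

theorem hasDerivWithinAt_comp_of_hasMFDerivWithinAt
    {F : Type*} [NormedAddCommGroup F] [NormedSpace ℝ F]
    {f : M → F} {c : ℝ → M} {s : Set ℝ} {t : ℝ}
    {c' : TangentSpace 𝓘(ℝ, ℝ) t →L[ℝ] TangentSpace 𝓘(ℝ, E) (c t)}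
    (hf : MDifferentiableAt 𝓘(ℝ, E) 𝓘(ℝ, F) f (c t))
    (hc : HasMFDerivWithinAt 𝓘(ℝ, ℝ) 𝓘(ℝ, E) c s t c') :
    HasDerivWithinAt (F := F) (f ∘ c) (mfderiv 𝓘(ℝ, E) 𝓘(ℝ, F) f (c t) (c' (1 : ℝ)) : F) s t := by
  have h : HasFDerivWithinAt (F := F) (f ∘ c)
      ((mfderiv 𝓘(ℝ, E) 𝓘(ℝ, F) f (c t) : E →L[ℝ] F).comp (c' : ℝ →L[ℝ] E)) s t :=
    (hf.hasMFDerivAt.comp_hasMFDerivWithinAt t hc).hasFDerivWithinAt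
  exact hasDerivWithinAt_of_hasFDerivWithinAt_comp (E := E) (F := F)
    (A := mfderiv 𝓘(ℝ, E) 𝓘(ℝ, F) f (c t)) (B := c') h

theorem hasDerivWithinAt_comp {F : Type*} [NormedAddCommGroup F] [NormedSpace ℝ F]
    {f : M → F} {c : ℝ → M} {s : Set ℝ} {t : ℝ}
    (hf : MDifferentiableAt 𝓘(ℝ, E) 𝓘(ℝ, F) f (c t))
    (hc : MDifferentiableWithinAt 𝓘(ℝ, ℝ) 𝓘(ℝ, E) c s t) :
    HasDerivWithinAt (F := F) (f ∘ c) (mfderiv 𝓘(ℝ, E) 𝓘(ℝ, F) f (c t) (velocity c s t) : F) s t :=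
  hasDerivWithinAt_comp_of_hasMFDerivWithinAt hf hc.hasMFDerivWithinAt

/-- The tangent space at `c t` is the model space read in the preferred chart at `c t`, so in that
chart no change of coordinates intervenes. -/
theorem derivWithin_extChartAt_comp_self {c : ℝ → M} {s : Set ℝ} {t : ℝ}
    (hc : MDifferentiableWithinAt 𝓘(ℝ, ℝ) 𝓘(ℝ, E) c s t) :
    derivWithin (F := E) (extChartAt 𝓘(ℝ, E) (c t) ∘ c) s t = velocity c s t := by
  unfold velocity
  rw [hc.mfderivWithin]
  simp only [writtenInExtChartAt, extChartAt_model_space_eq_id]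
  simp [Function.comp_def, ← fderivWithin_derivWithin]
  rfl

/-- The derivative of the inverse chart undoes that of the chart. The chart is centred at an
arbitrary `x`, which allows one fixed chart to serve for all nearby times. -/
theorem mfderiv_extChartAt_symm_derivWithin [IsManifold 𝓘(ℝ, E) ∞ M]
    {c : ℝ → M} {s : Set ℝ} {t : ℝ} {x : M}
    (hs : UniqueDiffWithinAt ℝ s t) (hc : MDifferentiableWithinAt 𝓘(ℝ, ℝ) 𝓘(ℝ, E) c s t)
    (hx : c t ∈ (extChartAt 𝓘(ℝ, E) x).source) :
    mfderiv 𝓘(ℝ, E) 𝓘(ℝ, E) (extChartAt 𝓘(ℝ, E) x).symm (extChartAt 𝓘(ℝ, E) x (c t))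
      (derivWithin (F := E) (extChartAt 𝓘(ℝ, E) x ∘ c) s t) = velocity c s t := by
  have h1 : derivWithin (F := E) (extChartAt 𝓘(ℝ, E) x ∘ c) s t =
      mfderiv 𝓘(ℝ, E) 𝓘(ℝ, E) (extChartAt 𝓘(ℝ, E) x) (c t) (velocity c s t) :=
    (hasDerivWithinAt_comp (mdifferentiableAt_extChartAt (I := 𝓘(ℝ, E)) (x := x)
      (by simpa using hx)) hc).derivWithin hs
  have h2 := mfderivWithin_extChartAt_symm_comp_mfderiv_extChartAt' (I := 𝓘(ℝ, E)) (x := x) hx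
  rw [modelWithCornersSelf_coe, range_id, mfderivWithin_univ] at h2
  exact (congrArg _ h1).trans (DFunLike.congr_fun h2 (velocity c s t))

theorem differentiableWithinAt_extChartAt_comp [IsManifold 𝓘(ℝ, E) ∞ M]
    {c : ℝ → M} {s : Set ℝ} {t : ℝ} {x : M}
    (hc : MDifferentiableWithinAt 𝓘(ℝ, ℝ) 𝓘(ℝ, E) c s t)
    (hx : c t ∈ (extChartAt 𝓘(ℝ, E) x).source) :
    DifferentiableWithinAt ℝ (extChartAt 𝓘(ℝ, E) x ∘ c) s t :=
  (hasDerivWithinAt_comp (mdifferentiableAt_extChartAt (I := 𝓘(ℝ, E)) (x := x)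
    (by simpa using hx)) hc).differentiableWithinAt

theorem contDiffWithinAt_extChartAt_comp {c : ℝ → M} {s : Set ℝ} {t : ℝ} {n : ℕ∞ω}
    (hc : ContMDiffWithinAt 𝓘(ℝ, ℝ) 𝓘(ℝ, E) n c s t) :
    ContDiffWithinAt ℝ n (extChartAt 𝓘(ℝ, E) (c t) ∘ c) s t := by
  have := (contMDiffWithinAt_iff.1 hc).2
  simp only [extChartAt_model_space_eq_id] at this
  simpa [Function.comp_def] using this

theorem hasDerivWithinAt_derivWithin {u : ℝ → E} {s : Set ℝ} {t : ℝ}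
    (hs : UniqueDiffOn ℝ s) (ht : t ∈ s) (hu : ContDiffWithinAt ℝ 2 u s t) :
    HasDerivWithinAt (derivWithin u s) (iteratedDerivWithin 2 u s t) s t := by
  have h1 : DifferentiableWithinAt ℝ (derivWithin u s) s t :=
    ((hu.fderivWithin_right hs (m := 1) (by norm_num) ht).differentiableWithinAt
      (by simp)).clm_apply (differentiableWithinAt_const (1 : ℝ))
  have h2 : iteratedDerivWithin 2 u s t = derivWithin (derivWithin u s) s t := by
    rw [iteratedDerivWithin_succ]
    exact derivWithin_congr (fun y hy => by rw [iteratedDerivWithin_one])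
      (by rw [iteratedDerivWithin_one])
  rw [h2]
  exact h1.hasDerivWithinAt

/-- Second-order chain rule. The acceleration is kept as a separate term because the geodesic
equation will replace it by a Christoffel term. -/
theorem hasDerivWithinAt_fderiv_derivWithin {F : E → ℝ} {u : ℝ → E} {s : Set ℝ} {t : ℝ}
    (hF : ContDiffAt ℝ ∞ F (u t)) (hs : UniqueDiffOn ℝ s) (ht : t ∈ s)
    (hu : ContDiffWithinAt ℝ 2 u s t) :
    HasDerivWithinAt (fun r => fderiv ℝ F (u r) (derivWithin u s r))
      (fderiv ℝ (fderiv ℝ F) (u t) (derivWithin u s t) (derivWithin u s t)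
        + fderiv ℝ F (u t) (iteratedDerivWithin 2 u s t)) s t := by
  have hu1 := (hu.differentiableWithinAt (by simp)).hasDerivWithinAt
  have hu2 := hasDerivWithinAt_derivWithin hs ht hu
  have hdF := ((hF.fderiv_right (m := 1) (by norm_cast)).differentiableAt
      (by simp)).hasFDerivAt
  exact (hdF.comp_hasDerivWithinAt t hu1).clm_apply hu2

/-- Product rule for the squared speed in coordinates: one term from the variation of the metric,
two from the acceleration. -/
theorem hasDerivWithinAt_bilinear_derivWithin {G : E → E →L[ℝ] E →L[ℝ] ℝ} {u : ℝ → E}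
    {s : Set ℝ} {t : ℝ} (hG : DifferentiableAt ℝ G (u t)) (hs : UniqueDiffOn ℝ s) (ht : t ∈ s)
    (hu : ContDiffWithinAt ℝ 2 u s t) :
    HasDerivWithinAt (fun r => G (u r) (derivWithin u s r) (derivWithin u s r))
      (fderiv ℝ G (u t) (derivWithin u s t) (derivWithin u s t) (derivWithin u s t)
        + G (u t) (iteratedDerivWithin 2 u s t) (derivWithin u s t)
        + G (u t) (derivWithin u s t) (iteratedDerivWithin 2 u s t)) s t := by
  have hu1 := (hu.differentiableWithinAt (by simp)).hasDerivWithinAt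
  have hu2 := hasDerivWithinAt_derivWithin hs ht hu
  have h0 : HasDerivWithinAt (fun r => G (u r)) (fderiv ℝ G (u t) (derivWithin u s t)) s t :=
    hasDerivWithinAt_comp_differentiableAt (W := E →L[ℝ] E →L[ℝ] ℝ) hG hu1
  have h1 : HasDerivWithinAt (fun r => G (u r) (derivWithin u s r))
      (fderiv ℝ G (u t) (derivWithin u s t) (derivWithin u s t)
        + G (u t) (iteratedDerivWithin 2 u s t)) s t := h0.clm_apply hu2
  exact h1.clm_apply hu2

theorem eventually_mem_source {c : ℝ → M} {s : Set ℝ} {t : ℝ} (hc : ContinuousWithinAt c s t) :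
    ∀ᶠ r in 𝓝[s] t, c r ∈ (extChartAt 𝓘(ℝ, E) (c t)).source :=
  hc.eventually (extChartAt_source_mem_nhds (I := 𝓘(ℝ, E)) (c t))

/-! ### Functions and the metric along geodesics -/

variable [IsManifold 𝓘(ℝ, E) ∞ M]

theorem contDiffAt_comp_extChartAt_symm {f : M → ℝ} (hf : ContMDiff 𝓘(ℝ, E) 𝓘(ℝ, ℝ) ∞ f)
    {x : M} {y : E} (hy : y ∈ (extChartAt 𝓘(ℝ, E) x).target) :
    ContDiffAt ℝ ∞ (f ∘ (extChartAt 𝓘(ℝ, E) x).symm) y := by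
  have h := (contMDiffOn_extChartAt_symm (I := 𝓘(ℝ, E)) (n := ∞) x).contMDiffAt
    ((isOpen_extChartAt_target x).mem_nhds hy)
  exact (hf.contMDiffAt.comp y h).contDiffAt

/-- The derivative of a function along a curve, computed in a chart. -/
theorem mfderiv_velocity_eq_fderiv {f : M → ℝ} (hf : ContMDiff 𝓘(ℝ, E) 𝓘(ℝ, ℝ) ∞ f)
    {c : ℝ → M} {s : Set ℝ} {t : ℝ} {x : M} (hs : UniqueDiffWithinAt ℝ s t)
    (hc : MDifferentiableWithinAt 𝓘(ℝ, ℝ) 𝓘(ℝ, E) c s t)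
    (hx : c t ∈ (extChartAt 𝓘(ℝ, E) x).source) :
    @Eq ℝ (mfderiv 𝓘(ℝ, E) 𝓘(ℝ, ℝ) f (c t) (velocity c s t))
      (fderiv ℝ (f ∘ (extChartAt 𝓘(ℝ, E) x).symm) (extChartAt 𝓘(ℝ, E) x (c t))
        (derivWithin (F := E) (extChartAt 𝓘(ℝ, E) x ∘ c) s t)) := by
  have h1 := hasDerivWithinAt_comp ((hf.contMDiffAt (x := c t)).mdifferentiableAt (by simp)) hc
  have h2 := hasDerivWithinAt_comp_differentiableAt ((contDiffAt_comp_extChartAt_symm hf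
    ((extChartAt 𝓘(ℝ, E) x).map_source hx)).differentiableAt (by simp))
    (differentiableWithinAt_extChartAt_comp hc hx).hasDerivWithinAt
  -- Both sides are derivatives at `t` of the same real function `f ∘ c`, computed on the manifold
  -- and in the chart; unique differentiability identifies them.
  refine hs.eq_deriv _ h1 (h2.congr_of_eventuallyEq ?_ ?_)
  · filter_upwards [hc.continuousWithinAt.eventually
      ((isOpen_extChartAt_source (I := 𝓘(ℝ, E)) x).mem_nhds hx)] with r hr
    simp only [Function.comp]
    rw [(extChartAt 𝓘(ℝ, E) x).left_inv hr]
  · simp only [Function.comp]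
    rw [(extChartAt 𝓘(ℝ, E) x).left_inv hx]

/-- Along a geodesic, the second derivative of a function is its Riemannian Hessian. -/
theorem IsGeodesicOn.hasDerivWithinAt_mfderiv_velocity {g : Metric E M} {c : ℝ → M} {s : Set ℝ}
    (hc : IsGeodesicOn g c s) (hs : UniqueDiffOn ℝ s) {f : M → ℝ}
    (hf : ContMDiff 𝓘(ℝ, E) 𝓘(ℝ, ℝ) ∞ f) {t : ℝ} (ht : t ∈ s) :
    HasDerivWithinAt (fun r => (mfderiv 𝓘(ℝ, E) 𝓘(ℝ, ℝ) f (c r) (velocity c s r) : ℝ))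
      (hessian g f (c t) (velocity c s t) (velocity c s t)) s t := by
  have hmd : ∀ r ∈ s, MDifferentiableWithinAt 𝓘(ℝ, ℝ) 𝓘(ℝ, E) c s r := fun r hr =>
    (hc.contMDiffOn r hr).mdifferentiableWithinAt (by simp)
  have hud := contDiffWithinAt_extChartAt_comp (hc.contMDiffOn t ht)
  have hFt := contDiffAt_comp_extChartAt_symm hf (mem_extChartAt_target (I := 𝓘(ℝ, E)) (c t))
  have hkey := hasDerivWithinAt_fderiv_derivWithin hFt hs ht hud
  refine (hkey.congr_of_eventuallyEq_of_mem ?_ ht).congr_deriv ?_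
  -- The chart at `c t` stays fixed while `r` varies; for `r` near `t` the curve remains in its
  -- domain.
  · filter_upwards [eventually_mem_source (E := E) (hmd t ht).continuousWithinAt,
      self_mem_nhdsWithin] with r hr hrs
    exact mfderiv_velocity_eq_fderiv hf (hs r hrs) (hmd r hrs) hr
  -- Substituting `u'' = -Γ(u', u')` turns `D²F(u', u') + DF(u'')` into the coordinate formula for
  -- the Hessian.
  · have hgeo := eq_neg_of_add_eq_zero_left (hc.geodesic_eq t ht)
    rw [hgeo, derivWithin_extChartAt_comp_self (hmd t ht), map_neg, ← sub_eq_add_neg]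
    rfl

/-- Smoothness of `g` is a statement about its expression in bundle trivializations. That expression
agrees near the centre with the pullback by the inverse chart, because the inverse of the tangent
trivialization is the derivative of the inverse chart. -/
theorem differentiableAt_metricInChart [FiniteDimensional ℝ E] (g : Metric E M) (x : M) :
    DifferentiableAt ℝ (metricInChart g x) (extChartAt 𝓘(ℝ, E) x x) := by
  have h1 := (Bundle.contMDiffAt_section _).1 (g.contMDiff x)
  have h2 := (contMDiffOn_extChartAt_symm (I := 𝓘(ℝ, E)) (n := ∞) x).contMDiffAt
    (extChartAt_target_mem_nhds (I := 𝓘(ℝ, E)) x)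
  have h3 := (ContMDiffAt.comp_of_eq h1 h2 (by simp)).contDiffAt.differentiableAt (by simp)
  refine h3.congr_of_eventuallyEq ?_
  filter_upwards [extChartAt_target_mem_nhds (I := 𝓘(ℝ, E)) x] with y hy
  simp only [Function.comp]
  rw [hom_trivializationAt_apply]
  ext v w
  have hz : (extChartAt 𝓘(ℝ, E) x).symm y ∈ (chartAt E x).source := by
    simpa using (extChartAt 𝓘(ℝ, E) x).map_target hy
  have hb : (extChartAt 𝓘(ℝ, E) x).symm y ∈ (trivializationAt (E →L[ℝ] ℝ)
      (fun x : M => TangentSpace 𝓘(ℝ, E) x →L[ℝ] ℝ) x).baseSet := by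
    rw [hom_trivializationAt_baseSet]
    exact ⟨by simpa using hz, by simp⟩
  have hs := TangentBundle.symmL_trivializationAt (I := 𝓘(ℝ, E)) hz
  rw [modelWithCornersSelf_coe, range_id, mfderivWithin_univ,
    (extChartAt 𝓘(ℝ, E) x).right_inv hy] at hs
  -- The trivialization of the cotangent bundle is precomposition with the inverse of the tangent
  -- trivialization.
  have hl : ∀ ψ : TangentSpace 𝓘(ℝ, E) ((extChartAt 𝓘(ℝ, E) x).symm y) →L[ℝ] ℝ,
      (Bundle.Trivialization.continuousLinearMapAt ℝ (trivializationAt (E →L[ℝ] ℝ)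
        (fun x : M => TangentSpace 𝓘(ℝ, E) x →L[ℝ] ℝ) x) ((extChartAt 𝓘(ℝ, E) x).symm y)) ψ w =
      ψ (Bundle.Trivialization.symmL ℝ
        (trivializationAt E (TangentSpace 𝓘(ℝ, E)) x) ((extChartAt 𝓘(ℝ, E) x).symm y) w) := by
    intro ψ
    rw [Bundle.Trivialization.continuousLinearMapAt_apply,
      Bundle.Trivialization.coe_linearMapAt_of_mem _ hb]
    simp [hom_trivializationAt_apply, ContinuousLinearMap.inCoordinates]
    rfl
  rw [ContinuousLinearMap.inCoordinates, ContinuousLinearMap.comp_apply,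
    ContinuousLinearMap.comp_apply, hl, hs]
  rfl

/-- The speed of a geodesic is constant. -/
theorem IsGeodesicOn.hasDerivWithinAt_inner_velocity [FiniteDimensional ℝ E] {g : Metric E M}
    {c : ℝ → M} {s : Set ℝ} (hc : IsGeodesicOn g c s) (hs : UniqueDiffOn ℝ s) {t : ℝ}
    (ht : t ∈ s) :
    HasDerivWithinAt (fun r => g.inner (c r) (velocity c s r) (velocity c s r)) 0 s t := by
  have hmd : ∀ r ∈ s, MDifferentiableWithinAt 𝓘(ℝ, ℝ) 𝓘(ℝ, E) c s r := fun r hr =>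
    (hc.contMDiffOn r hr).mdifferentiableWithinAt (by simp)
  have hud := contDiffWithinAt_extChartAt_comp (hc.contMDiffOn t ht)
  have hkey := hasDerivWithinAt_bilinear_derivWithin (differentiableAt_metricInChart g (c t))
    hs ht hud
  refine (hkey.congr_of_eventuallyEq_of_mem ?_ ht).congr_deriv ?_
  · filter_upwards [eventually_mem_source (E := E) (hmd t ht).continuousWithinAt,
      self_mem_nhdsWithin] with r hr hrs
    have h1 := mfderiv_extChartAt_symm_derivWithin (hs r hrs) (hmd r hrs) hr
    have h2 : (extChartAt 𝓘(ℝ, E) (c t)).symm (extChartAt 𝓘(ℝ, E) (c t) (c r)) = c r :=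
      (extChartAt 𝓘(ℝ, E) (c t)).left_inv hr
    -- The coordinate metric is based at the image of `c r` under the chart and back, a point only
    -- propositionally equal to `c r`; this transports the form between the two base points.
    have h3 : ∀ z, z = c r → ∀ v : E, g.inner (c r) v v = g.inner z v v := by
      rintro z rfl v; rfl
    exact (congrArg (fun v : E => g.inner (c r) v v) h1.symm).trans (h3 _ h2 _)
  · have hgeo := eq_neg_of_add_eq_zero_left (hc.geodesic_eq t ht)
    rw [hgeo]
    have hsymm : ∀ y (v w : E), metricInChart g (c t) y v w = metricInChart g (c t) y w v :=
      fun y v w => g.symm _ _ _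
    simp only [map_neg, neg_apply,
      Function.comp]
    -- By symmetry both acceleration terms equal `-G(Γ(u', u'), u')`. With all three arguments
    -- equal, the Christoffel formula makes each of them `-D_{u'}G(u', u') / 2`, and together they
    -- cancel the derivative of the metric.
    rw [hsymm _ _ (christoffel _ _ _ _ _),
      metricInChart_christoffel g (c t) _ (mem_extChartAt_target (c t))]
    ring

end Riem

/-! ### Strong convexity along geodesics and its consequences -/

namespace Riem

/-- Subtracting the quadratic with second derivative `k` leaves a function whose derivative is
nondecreasing, hence nonnegative once normalized to vanish at `0`; so the function itself is
nondecreasing. Derivatives within `[0, 1]` suffice, as for a geodesic segment. -/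
theorem taylor_lower_bound {φ ψ χ : ℝ → ℝ} {k : ℝ}
    (hφ : ∀ t ∈ Icc (0 : ℝ) 1, HasDerivWithinAt φ (ψ t) (Icc 0 1) t)
    (hψ : ∀ t ∈ Icc (0 : ℝ) 1, HasDerivWithinAt ψ (χ t) (Icc 0 1) t)
    (hχ : ∀ t ∈ Icc (0 : ℝ) 1, k ≤ χ t) : φ 0 + ψ 0 + k / 2 ≤ φ 1 := by
  have h0 : (0 : ℝ) ∈ Icc (0 : ℝ) 1 := by simp
  have h1 : (1 : ℝ) ∈ Icc (0 : ℝ) 1 := by simp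
  have d1 : ∀ t ∈ Icc (0 : ℝ) 1, HasDerivWithinAt (fun t => ψ t - k * t) (χ t - k * 1)
      (Icc 0 1) t := fun t ht => (hψ t ht).sub ((hasDerivWithinAt_id t _).const_mul k)
  have m1 : MonotoneOn (fun t => ψ t - k * t) (Icc 0 1) :=
    monotoneOn_of_hasDerivWithinAt_nonneg (convex_Icc 0 1)
      (fun t ht => (d1 t ht).continuousWithinAt)
      (fun t ht => (d1 t (interior_subset ht)).mono interior_subset)
      (fun t ht => by linarith [hχ t (interior_subset ht)])
  have d2 : ∀ t ∈ Icc (0 : ℝ) 1, HasDerivWithinAt (fun t => φ t - ψ 0 * t - k / 2 * t ^ 2)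
      (ψ t - ψ 0 * 1 - k / 2 * (2 * t)) (Icc 0 1) t := fun t ht =>
    (((hφ t ht).sub ((hasDerivWithinAt_id t _).const_mul (ψ 0))).sub
      (((hasDerivAt_pow 2 t).hasDerivWithinAt.const_mul (k / 2)))).congr_deriv (by simp)
  have m2 : MonotoneOn (fun t => φ t - ψ 0 * t - k / 2 * t ^ 2) (Icc 0 1) :=
    monotoneOn_of_hasDerivWithinAt_nonneg (convex_Icc 0 1)
      (fun t ht => (d2 t ht).continuousWithinAt)
      (fun t ht => (d2 t (interior_subset ht)).mono interior_subset)
      (fun t ht => by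
        have ht' := interior_subset ht
        have := m1 h0 ht' ht'.1
        simp only [mul_zero, sub_zero] at this
        linarith)
  have := m2 h0 h1 zero_le_one
  simp only [mul_zero, sub_zero] at this
  linarith

variable {E : Type*} [NormedAddCommGroup E] [NormedSpace ℝ E]
  {M : Type*} [TopologicalSpace M] [ChartedSpace E M] [IsManifold 𝓘(ℝ, E) ∞ M]

/-- A curve with vanishing velocity is constant. -/
theorem eq_of_velocity_eq_zero {c : ℝ → M} {s : Set ℝ} (hs : Convex ℝ s)
    (hc : ∀ t ∈ s, MDifferentiableWithinAt 𝓘(ℝ, ℝ) 𝓘(ℝ, E) c s t)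
    (hv : ∀ t ∈ s, velocity (E := E) c s t = 0) {a b : ℝ} (ha : a ∈ s) (hb : b ∈ s) :
    c a = c b := by
  have hloc : ∀ t ∈ s, ∀ᶠ r in 𝓝[s] t, c r = c t := by
    intro t ht
    obtain ⟨ε, hε, hball⟩ := Metric.mem_nhdsWithin_iff.1
      (eventually_mem_source (E := E) (hc t ht).continuousWithinAt)
    -- In one chart the coordinates have zero derivative on a convex set, hence are constant there,
    -- and the chart is injective. Connectedness of `s` then makes the locally constant curve
    -- constant.
    have hd : ∀ r ∈ Metric.ball t ε ∩ s, HasDerivWithinAt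
        (extChartAt 𝓘(ℝ, E) (c t) ∘ c) 0 (Metric.ball t ε ∩ s) r := by
      intro r hr
      have h1 := hasDerivWithinAt_comp (mdifferentiableAt_extChartAt (I := 𝓘(ℝ, E)) (x := c t)
        (by simpa using hball hr)) (hc r hr.2)
      rw [hv r hr.2, map_zero] at h1
      exact h1.mono inter_subset_right
    filter_upwards [self_mem_nhdsWithin, mem_nhdsWithin_of_mem_nhds (Metric.ball_mem_nhds t hε)]
      with r hrs hrb
    have h2 := ((convex_ball t ε).inter hs).norm_image_sub_le_of_norm_hasDerivWithin_le
      (C := 0) hd (by simp) ⟨Metric.mem_ball_self hε, ht⟩ ⟨hrb, hrs⟩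
    rw [zero_mul, norm_le_zero_iff, sub_eq_zero] at h2
    exact (extChartAt 𝓘(ℝ, E) (c t)).injOn (hball ⟨hrb, hrs⟩)
      (mem_extChartAt_source (I := 𝓘(ℝ, E)) (c t)) h2
  have hlc : IsLocallyConstant (s.domRestrict c) := by
    refine (IsLocallyConstant.iff_eventually_eq _).2 fun t => ?_
    have := hloc t t.2
    rw [nhdsWithin_eq_map_subtype_coe t.2] at this
    exact this
  have : PreconnectedSpace s := Subtype.preconnectedSpace hs.isPreconnected
  exact hlc.apply_eq_of_preconnectedSpace ⟨a, ha⟩ ⟨b, hb⟩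

theorem inner_self_nonneg (g : Metric E M) (x : M) (v : TangentSpace 𝓘(ℝ, E) x) :
    0 ≤ g.inner x v v := by
  by_cases hv : v = 0
  · simp [hv]
  · exact (g.pos x v hv).le

theorem IsGeodesicOn.mdifferentiableWithinAt {g : Metric E M} {c : ℝ → M} {s : Set ℝ}
    (hc : IsGeodesicOn g c s) {t : ℝ} (ht : t ∈ s) :
    MDifferentiableWithinAt 𝓘(ℝ, ℝ) 𝓘(ℝ, E) c s t :=
  (hc.contMDiffOn t ht).mdifferentiableWithinAt (by simp)

variable [FiniteDimensional ℝ E]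

theorem IsGeodesicOn.inner_velocity_eq {g : Metric E M} {c : ℝ → M}
    (hc : IsGeodesicOn g c (Icc 0 1)) {t : ℝ} (ht : t ∈ Icc (0 : ℝ) 1) :
    g.inner (c t) (velocity c (Icc 0 1) t) (velocity c (Icc 0 1) t) =
      g.inner (c 0) (velocity c (Icc 0 1) 0) (velocity c (Icc 0 1) 0) := by
  have h := (convex_Icc (0 : ℝ) 1).norm_image_sub_le_of_norm_hasDerivWithin_le (C := 0)
    (fun r hr => hc.hasDerivWithinAt_inner_velocity (uniqueDiffOn_Icc zero_lt_one) hr) (by simp)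
    (left_mem_Icc.2 zero_le_one) ht
  rwa [zero_mul, norm_le_zero_iff, sub_eq_zero] at h

/-- Strong convexity along a geodesic. -/
theorem IsGeodesicOn.add_le_of_hessian_ge {g : Metric E M} {c : ℝ → M}
    (hc : IsGeodesicOn g c (Icc 0 1)) {f : M → ℝ} (hf : ContMDiff 𝓘(ℝ, E) 𝓘(ℝ, ℝ) ∞ f)
    {U : Set M} (hcU : ∀ t ∈ Icc (0 : ℝ) 1, c t ∈ U) {μ : ℝ}
    (hμ : ∀ x ∈ U, ∀ ξ : TangentSpace 𝓘(ℝ, E) x, μ * g.inner x ξ ξ ≤ hessian g f x ξ ξ) :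
    f (c 0) + g.inner (c 0) (grad g f (c 0)) (velocity c (Icc 0 1) 0)
      + μ * g.inner (c 0) (velocity c (Icc 0 1) 0) (velocity c (Icc 0 1) 0) / 2 ≤ f (c 1) := by
  rw [inner_grad]
  refine taylor_lower_bound (φ := f ∘ c)
    (fun t ht => hasDerivWithinAt_comp ((hf.contMDiffAt (x := c t)).mdifferentiableAt (by simp))
      (hc.mdifferentiableWithinAt ht))
    (fun t ht => hc.hasDerivWithinAt_mfderiv_velocity (uniqueDiffOn_Icc zero_lt_one) hf ht)
    (fun t ht => ?_)
  rw [← hc.inner_velocity_eq ht]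
  exact hμ _ (hcU t ht) _

/-- A critical point of a strongly geodesically convex function is its unique minimizer. -/
theorem isMinOn_and_unique_of_hessian_ge {g : Metric E M} {f : M → ℝ}
    (hf : ContMDiff 𝓘(ℝ, E) 𝓘(ℝ, ℝ) ∞ f) {U : Set M} (hU : GeodesicallyConvex g U) {μ : ℝ}
    (hμ : 0 < μ)
    (hH : ∀ x ∈ U, ∀ ξ : TangentSpace 𝓘(ℝ, E) x, μ * g.inner x ξ ξ ≤ hessian g f x ξ ξ)
    {x : M} (hx : x ∈ U) (hcrit : mfderiv 𝓘(ℝ, E) 𝓘(ℝ, ℝ) f x = 0) :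
    IsMinOn f U x ∧ ∀ y ∈ U, IsMinOn f U y → y = x := by
  refine ⟨fun y hy => ?_, fun y hy hmin => ?_⟩
  all_goals
    obtain ⟨c, hc, rfl, rfl, hcU⟩ := hU x hx y hy
    have h1 := hc.add_le_of_hessian_ge hf hcU hH
    have h0 : g.inner (c 0) (grad g f (c 0)) (velocity c (Icc 0 1) 0) = 0 :=
      (inner_grad g f _ _).trans (DFunLike.congr_fun hcrit _)
    rw [h0] at h1
    have h2 := inner_self_nonneg g (c 0) (velocity c (Icc 0 1) 0)
  · change f (c 0) ≤ f (c 1)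
    have := mul_nonneg hμ.le h2
    linarith
  · have h3 : f (c 1) ≤ f (c 0) := hmin hx
    -- Equal minimal values leave no room for the term `μ |v|² / 2`, so the initial speed vanishes,
    -- and by constancy so does the speed at all times.
    have h4 : g.inner (c 0) (velocity c (Icc 0 1) 0) (velocity c (Icc 0 1) 0) = 0 := by
      nlinarith
    refine eq_of_velocity_eq_zero (E := E) (convex_Icc 0 1)
      (fun t ht => hc.mdifferentiableWithinAt ht) (fun t ht => ?_)
      (right_mem_Icc.2 zero_le_one) (left_mem_Icc.2 zero_le_one)
    by_contra hv
    exact (g.pos _ _ hv).ne' ((hc.inner_velocity_eq ht).trans h4)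

/-- The Polyak–Łojasiewicz inequality for strongly geodesically convex functions. -/
theorem two_mul_sub_le_inner_grad {g : Metric E M} {f : M → ℝ}
    (hf : ContMDiff 𝓘(ℝ, E) 𝓘(ℝ, ℝ) ∞ f) {U : Set M} (hU : GeodesicallyConvex g U) {μ : ℝ}
    (hμ : 0 < μ)
    (hH : ∀ x ∈ U, ∀ ξ : TangentSpace 𝓘(ℝ, E) x, μ * g.inner x ξ ξ ≤ hessian g f x ξ ξ)
    {x y : M} (hx : x ∈ U) (hy : y ∈ U) :
    2 * μ * (f x - f y) ≤ g.inner x (grad g f x) (grad g f x) := by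
  obtain ⟨c, hc, rfl, rfl, hcU⟩ := hU x hx y hy
  have h1 := hc.add_le_of_hessian_ge hf hcU hH
  -- Completing the square: expanding `0 ≤ |grad f + μ v|²` bounds `-2μ ⟨grad f, v⟩ - μ² |v|²` by
  -- `|grad f|²`, which is what `2μ` times the convexity inequality requires.
  have h2 := inner_self_nonneg g (c 0) (grad g f (c 0) + μ • velocity c (Icc 0 1) 0)
  have h3 : g.inner (c 0) (velocity c (Icc 0 1) 0) (grad g f (c 0)) =
    g.inner (c 0) (grad g f (c 0)) (velocity c (Icc 0 1) 0) := g.symm _ _ _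
  simp only [map_add, map_smul, add_apply, smul_apply, smul_eq_mul, h3] at h2
  nlinarith

/-! ### Decay along the gradient flow -/

theorem convex_timeInterval (T : EReal) : Convex ℝ (timeInterval T) := by
  refine (ordConnected_def.2 fun a ha b hb t ht => ?_).convex
  exact ⟨ha.1.trans ht.1, lt_of_le_of_lt (EReal.coe_le_coe_iff.2 ht.2) hb.2⟩

/-- Exponential convergence of the gradient flow under strong geodesic convexity. -/
theorem IsGradientFlow.sub_le_exp_mul {g : Metric E M} {f : M → ℝ}
    (hf : ContMDiff 𝓘(ℝ, E) 𝓘(ℝ, ℝ) ∞ f) {U : Set M} (hU : GeodesicallyConvex g U) {μ : ℝ}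
    (hμ : 0 < μ)
    (hH : ∀ x ∈ U, ∀ ξ : TangentSpace 𝓘(ℝ, E) x, μ * g.inner x ξ ξ ≤ hessian g f x ξ ξ)
    {y : M} (hy : y ∈ U) {T : EReal} {γ : ℝ → M} (hγU : ∀ t ∈ timeInterval T, γ t ∈ U)
    (hγ : IsGradientFlow g f γ T) {t : ℝ} (ht : t ∈ timeInterval T) :
    f (γ t) - f y ≤ Real.exp (-2 * μ * t) * (f (γ 0) - f y) := by
  have hd : ∀ r ∈ timeInterval T, HasDerivWithinAt (f ∘ γ)
      (-g.inner (γ r) (grad g f (γ r)) (grad g f (γ r))) (timeInterval T) r := by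
    intro r hr
    have h1 := hasDerivWithinAt_comp_of_hasMFDerivWithinAt
      ((hf.contMDiffAt (x := γ r)).mdifferentiableAt (by simp)) (hγ.2 r hr)
    have h2 : (1 : ℝ →L[ℝ] ℝ).smulRight (-grad g f (γ r)) (1 : ℝ) = -grad g f (γ r) :=
      one_smul ℝ _
    exact h1.congr_deriv ((congrArg (mfderiv 𝓘(ℝ, E) 𝓘(ℝ, ℝ) f (γ r)) h2).trans
      ((map_neg _ _).trans (congrArg Neg.neg (inner_grad g f _ _).symm)))
  -- The integrating factor `exp (2μr)`: the derivative is `exp (2μr)` times `2μ (f - f y) - |grad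
  -- f|²`, nonpositive by the Polyak–Łojasiewicz inequality.
  have hd2 : ∀ r ∈ timeInterval T, HasDerivWithinAt
      (fun r => Real.exp (2 * μ * r) * ((f ∘ γ) r - f y))
      (Real.exp (2 * μ * r) * (2 * μ * 1) * ((f ∘ γ) r - f y) + Real.exp (2 * μ * r) *
        (-g.inner (γ r) (grad g f (γ r)) (grad g f (γ r)))) (timeInterval T) r := fun r hr =>
    (((hasDerivWithinAt_id r _).const_mul (2 * μ)).exp).mul ((hd r hr).sub_const _)
  have hanti : AntitoneOn (fun r => Real.exp (2 * μ * r) * ((f ∘ γ) r - f y))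
      (timeInterval T) :=
    antitoneOn_of_hasDerivWithinAt_nonpos (convex_timeInterval T)
      (fun r hr => (hd2 r hr).continuousWithinAt)
      (fun r hr => (hd2 r (interior_subset hr)).mono interior_subset)
      (fun r hr => by
        have h1 := two_mul_sub_le_inner_grad hf hU hμ hH (hγU r (interior_subset hr)) hy
        have h2 := Real.exp_pos (2 * μ * r)
        simp only [Function.comp]
        nlinarith)
  have h0 : (0 : ℝ) ∈ timeInterval T :=
    ⟨le_rfl, lt_of_le_of_lt (EReal.coe_le_coe_iff.2 ht.1) ht.2⟩
  have h := hanti h0 ht ht.1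
  simp only [mul_zero, Real.exp_zero, one_mul, Function.comp] at h
  have h3 : Real.exp (-2 * μ * t) * Real.exp (2 * μ * t) = 1 := by
    rw [← Real.exp_add]
    simp
  calc f (γ t) - f y = Real.exp (-2 * μ * t) * (Real.exp (2 * μ * t) * (f (γ t) - f y)) := by
        rw [← mul_assoc, h3, one_mul]
    _ ≤ _ := mul_le_mul_of_nonneg_left h (Real.exp_pos _).le

/-! ### Effective eigenvalues and condition number -/

omit [FiniteDimensional ℝ E] in
/-- Bounds on the Hessian bound the effective extremal eigenvalues and condition number. -/
theorem lambda_kappa_bounds [Nontrivial E] {g : Metric E M} {f : M → ℝ} {x : M} {μ L : ℝ}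
    (hμ : 0 < μ) (hμL : μ ≤ L)
    (hH : ∀ ξ : TangentSpace 𝓘(ℝ, E) x,
      μ * g.inner x ξ ξ ≤ hessian g f x ξ ξ ∧ hessian g f x ξ ξ ≤ L * g.inner x ξ ξ) :
    μ ≤ lambdaMin g f x ∧ lambdaMax g f x ≤ L ∧ kappa g f x ≤ L / μ := by
  obtain ⟨v, hv⟩ : ∃ v : TangentSpace 𝓘(ℝ, E) x, v ≠ 0 := exists_ne (0 : E)
  -- Nonemptiness matters: the infimum of the empty set of reals is `0`, which would violate the
  -- lower bound `μ`.
  have hne : (rayleighSet g f x).Nonempty := ⟨_, v, hv, rfl⟩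
  have h1 : μ ≤ lambdaMin g f x := by
    refine le_csInf hne ?_
    rintro r ⟨ξ, hξ, rfl⟩
    exact (le_div_iff₀ (g.pos x ξ hξ)).2 (hH ξ).1
  have h2 : lambdaMax g f x ≤ L := by
    refine csSup_le hne ?_
    rintro r ⟨ξ, hξ, rfl⟩
    exact (div_le_iff₀ (g.pos x ξ hξ)).2 (hH ξ).2
  exact ⟨h1, h2, div_le_div₀ (hμ.le.trans hμL) h2 hμ h1⟩

end Riem

/-! ### The theorem on the regular quotient -/

theorem mainTheorem4 {m d n : ℕ} (N : RegularNetwork m d n)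
    (Lbar : N.Quot → ℝ)
    (hLbar : ContMDiff 𝓘(ℝ, RegularNetwork.Model m d) 𝓘(ℝ, ℝ) ∞ Lbar)
    (xstar : N.Quot)
    (hcrit : mfderiv 𝓘(ℝ, RegularNetwork.Model m d) 𝓘(ℝ, ℝ) Lbar xstar = 0)
    (U : Set N.Quot) (hU : IsOpen U) (hxU : xstar ∈ U)
    (hconv : Riem.GeodesicallyConvex N.metric U)
    (μ L : ℝ) (hμ : 0 < μ) (hμL : μ ≤ L)
    (hHess : ∀ x ∈ U, ∀ ξ : TangentSpace 𝓘(ℝ, RegularNetwork.Model m d) x,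
      μ * N.metric.inner x ξ ξ ≤ Riem.hessian N.metric Lbar x ξ ξ ∧
        Riem.hessian N.metric Lbar x ξ ξ ≤ L * N.metric.inner x ξ ξ) :
    (IsMinOn Lbar U xstar ∧ ∀ y ∈ U, IsMinOn Lbar U y → y = xstar) ∧
    (∀ (T : EReal) (γ : ℝ → N.Quot), (∀ t ∈ Riem.timeInterval T, γ t ∈ U) →
      Riem.IsGradientFlow N.metric Lbar γ T → ∀ t ∈ Riem.timeInterval T,
        Lbar (γ t) - Lbar xstar ≤ Real.exp (-2 * μ * t) * (Lbar (γ 0) - Lbar xstar)) ∧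
    (0 < m * d → ∀ x ∈ U, μ ≤ Riem.lambdaMin N.metric Lbar x ∧
      Riem.lambdaMax N.metric Lbar x ≤ L ∧ Riem.kappa N.metric Lbar x ≤ L / μ) := by
  have hH : ∀ x ∈ U, ∀ ξ : TangentSpace 𝓘(ℝ, RegularNetwork.Model m d) x,
      μ * N.metric.inner x ξ ξ ≤ Riem.hessian N.metric Lbar x ξ ξ := fun x hx ξ =>
    (hHess x hx ξ).1
  refine ⟨Riem.isMinOn_and_unique_of_hessian_ge hLbar hconv hμ hH hxU hcrit,
    fun T γ hγU hγ t ht => hγ.sub_le_exp_mul hLbar hconv hμ hH hxU hγU ht,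
    fun hmd x hx => ?_⟩
  -- Positive dimension makes the model space nontrivial, so that Rayleigh quotients exist.
  have : Nonempty (Fin (m * d)) := ⟨⟨0, hmd⟩⟩
  exact Riem.lambda_kappa_bounds hμ hμL (hHess x hx)
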